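/- Let $a(n)$, $d(n)$ and $e(n)$ be the numbers of directed acyclic graphs (DAGs), of essential DAGs, and of extensional DAGs on $n$ labelled vertices. Here a DAG is \emph{essential} if $N^-(u)\neq N^-(v)\setminus\{u\}$ for every edge $(u,v)$, and \emph{extensional} if $N^+(x)\neq N^+(y)$ for all distinct vertices $x,y$, where $N^-$ and $N^+$ denote the sets of in-neighbours and out-neighbours. Let $M$ be a nondecreasing function on the positive integers with $M\ge 1$. Consider a random access machine on natural numbers in which every elementary operation (copying, addition, subtraction, comparison, binary shift, bit length, reading or writing an array entry) is charged linearly in the number of bits of the numbers and array indices involved (a left shift linearly in the number of bits shifted plus the shift amount), and in which two numbers of at most $t\geq 1$ bits are multiplied in additional time at most $t\,M(t)$. Write $\ell(n,\varepsilon)=\max(1,\lceil\log_2(n/\varepsilon)\rceil)$. Then for each of the three functions $f\in\{a,d,e\}$ there is a program for this machine and a constant $C$ such that, for every integer $n\geq 1$ and every real $0<\varepsilon\leq 1$, the program, given $n$ and $\lceil 1/\varepsilon\rceil$, computes natural numbers $m$ (mantissa) and $p$ (exponent) with at most $C\,\ell(n,\varepsilon)$ bits in total such that the number $Z=m\cdot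 2^{p}$ satisfies $$(1-\varepsilon)\,f(n)\;\leq\; Z\;\leq\; f(n),$$ in time at most $C\,n^3\,\ell(n,\varepsilon)\,M(\ell(n,\varepsilon))$. That is, an $O(\log(n/\varepsilon))$-bit floating-point number $Z$ is computed in time $O(n^3\log(n/\varepsilon)M(\log(n/\varepsilon)))$. -/

import Mathlib

/-! ## The three families of labelled directed acyclic graphs -/

/-- A directed graph is acyclic if no vertex lies on a directed closed walk of positive length
(in particular there are no loops). -/
def Digraph.IsDAG {V : Type*} (D : Digraph V) : Prop :=
  ∀ v : V, ¬ Relation.TransGen D.Adj v v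

/-- The set of in-neighbours of `v`. -/
def Digraph.inNbrs {V : Type*} (D : Digraph V) (v : V) : Set V := {u | D.Adj u v}

/-- The set of out-neighbours of `v`. -/
def Digraph.outNbrs {V : Type*} (D : Digraph V) (v : V) : Set V := {w | D.Adj v w}

/-- Essential DAGs: for every edge `(u, v)`, the set of in-neighbours of `u` differs from the set
of in-neighbours of `v` minus `u`. -/
def Digraph.IsEssentialDAG {V : Type*} (D : Digraph V) : Prop :=
  D.IsDAG ∧ ∀ u v : V, D.Adj u v → D.inNbrs u ≠ D.inNbrs v \ {u}

/-- Extensional DAGs: distinct vertices have distinct sets of out-neighbours. -/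
def Digraph.IsExtensionalDAG {V : Type*} (D : Digraph V) : Prop :=
  D.IsDAG ∧ ∀ x y : V, x ≠ y → D.outNbrs x ≠ D.outNbrs y

/-- `a(n)`, the number of DAGs on `n` labelled vertices. -/
noncomputable def numDAG (n : ℕ) : ℕ :=
  Nat.card {D : Digraph (Fin n) // D.IsDAG}

/-- `d(n)`, the number of essential DAGs on `n` labelled vertices. -/
noncomputable def numEssentialDAG (n : ℕ) : ℕ :=
  Nat.card {D : Digraph (Fin n) // D.IsEssentialDAG}

/-- `e(n)`, the number of extensional DAGs on `n` labelled vertices. -/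
noncomputable def numExtensionalDAG (n : ℕ) : ℕ :=
  Nat.card {D : Digraph (Fin n) // D.IsExtensionalDAG}

/-! ## A random access machine with bit cost -/

/-- A memory state: registers `x₀, x₁, …` and arrays `A₀, A₁, …`, all holding natural numbers.
(A program is a finite text in which registers and arrays are named by constants, so it uses only
finitely many of them; arrays have no fixed length.) -/
structure RamState where
  /-- the contents of the registers -/
  reg : ℕ → ℕ
  /-- `arr a i` is the entry number `i` of the array `a` -/
  arr : ℕ → ℕ → ℕ

/-- Write `v` into register `x`. -/
def RamState.setReg (σ : RamState) (x v : ℕ) : RamState :=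
  { σ with reg := Function.update σ.reg x v }

/-- Write `v` into entry `i` of array `a`. -/
def RamState.setArr (σ : RamState) (a i v : ℕ) : RamState :=
  { σ with arr := Function.update σ.arr a (Function.update (σ.arr a) i v) }

/-- Elementary instructions; `x y z` name registers and `a` names an array. -/
inductive RamInstr
  /-- `x := c` for a constant `c` -/
  | const (x c : ℕ)
  /-- `x := y` -/
  | move (x y : ℕ)
  /-- `x := y + z` -/
  | add (x y z : ℕ)
  /-- `x := max (y - z) 0` -/
  | sub (x y z : ℕ)
  /-- `x := y * z` -/
  | mul (x y z : ℕ)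
  /-- `x := y * 2 ^ z` -/
  | shiftL (x y z : ℕ)
  /-- `x := ⌊y / 2 ^ z⌋` -/
  | shiftR (x y z : ℕ)
  /-- `x := ` the number of binary digits of `y` -/
  | len (x y : ℕ)
  /-- `x := A_a[y]` -/
  | load (x a y : ℕ)
  /-- `A_a[x] := y` -/
  | store (a x y : ℕ)

/-- The effect of an instruction. -/
def RamInstr.eval : RamInstr → RamState → RamState
  | const x c, σ => σ.setReg x c
  | move x y, σ => σ.setReg x (σ.reg y)
  | add x y z, σ => σ.setReg x (σ.reg y + σ.reg z)
  | sub x y z, σ => σ.setReg x (σ.reg y - σ.reg z)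
  | mul x y z, σ => σ.setReg x (σ.reg y * σ.reg z)
  | shiftL x y z, σ => σ.setReg x (σ.reg y * 2 ^ σ.reg z)
  | shiftR x y z, σ => σ.setReg x (σ.reg y / 2 ^ σ.reg z)
  | len x y, σ => σ.setReg x (Nat.size (σ.reg y))
  | load x a y, σ => σ.setReg x (σ.arr a (σ.reg y))
  | store a x y, σ => σ.setArr a (σ.reg x) (σ.reg y)

/-- The time taken by an instruction. Every instruction is charged linearly in the number of bits
of the numbers (and array indices) that it reads and writes, except that a multiplication of two
numbers of at most `t` bits is charged `mulCost t` in addition. -/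
def RamInstr.cost (mulCost : ℕ → ℕ) : RamInstr → RamState → ℕ
  | const _ c, _ => 1 + Nat.size c
  | move _ y, σ => 1 + Nat.size (σ.reg y)
  | add _ y z, σ => 1 + Nat.size (σ.reg y) + Nat.size (σ.reg z)
  | sub _ y z, σ => 1 + Nat.size (σ.reg y) + Nat.size (σ.reg z)
  | mul _ y z, σ => 1 + Nat.size (σ.reg y) + Nat.size (σ.reg z)
      + mulCost (max (Nat.size (σ.reg y)) (Nat.size (σ.reg z)))
  | shiftL _ y z, σ => 1 + Nat.size (σ.reg y) + σ.reg z
  | shiftR _ y z, σ => 1 + Nat.size (σ.reg y) + Nat.size (σ.reg z)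
  | len _ y, σ => 1 + Nat.size (σ.reg y)
  | load _ a y, σ => 1 + Nat.size (σ.reg y) + Nat.size (σ.arr a (σ.reg y))
  | store _ x y, σ => 1 + Nat.size (σ.reg x) + Nat.size (σ.reg y)

/-- Programs of the machine. -/
inductive RamProg
  | skip
  | instr (i : RamInstr)
  | seq (p q : RamProg)
  /-- `if x < y then p else q`, for registers `x`, `y` -/
  | ite (x y : ℕ) (p q : RamProg)
  /-- `while x < y do p`, for registers `x`, `y` -/
  | loop (x y : ℕ) (p : RamProg)

/-- The time taken by comparing the registers `x` and `y`. -/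
def RamState.testCost (σ : RamState) (x y : ℕ) : ℕ :=
  1 + Nat.size (σ.reg x) + Nat.size (σ.reg y)

/-- `RamExec mulCost p σ c τ`: started in state `σ`, the program `p` halts in state `τ` after total
time `c`. -/
inductive RamExec (mulCost : ℕ → ℕ) : RamProg → RamState → ℕ → RamState → Prop
  | skip (σ : RamState) : RamExec mulCost .skip σ 0 σ
  | instr (i : RamInstr) (σ : RamState) :
      RamExec mulCost (.instr i) σ (i.cost mulCost σ) (i.eval σ)
  | seq {p q : RamProg} {σ τ υ : RamState} {c c' : ℕ} :
      RamExec mulCost p σ c τ → RamExec mulCost q τ c' υ →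
      RamExec mulCost (.seq p q) σ (c + c') υ
  | iteTrue {x y : ℕ} {p q : RamProg} {σ τ : RamState} {c : ℕ} :
      σ.reg x < σ.reg y → RamExec mulCost p σ c τ →
      RamExec mulCost (.ite x y p q) σ (σ.testCost x y + c) τ
  | iteFalse {x y : ℕ} {p q : RamProg} {σ τ : RamState} {c : ℕ} :
      ¬ σ.reg x < σ.reg y → RamExec mulCost q σ c τ →
      RamExec mulCost (.ite x y p q) σ (σ.testCost x y + c) τ
  | loopTrue {x y : ℕ} {p : RamProg} {σ τ υ : RamState} {c c' : ℕ} :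
      σ.reg x < σ.reg y → RamExec mulCost p σ c τ → RamExec mulCost (.loop x y p) τ c' υ →
      RamExec mulCost (.loop x y p) σ (σ.testCost x y + c + c') υ
  | loopFalse {x y : ℕ} {p : RamProg} {σ : RamState} :
      ¬ σ.reg x < σ.reg y → RamExec mulCost (.loop x y p) σ (σ.testCost x y) σ

/-- The initial state: the two inputs are in registers `0` and `1`, everything else is `0`. -/
def RamState.init (n q : ℕ) : RamState where
  reg x := if x = 0 then n else if x = 1 then q else 0
  arr _ _ := 0

/-! ## Fast deterministic approximate counting -/

/-- `log₂ (n / ε)`, rounded up to an integer, and replaced by `1` where it is smaller than `1`. -/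
noncomputable def logRatio (n : ℕ) (ε : ℝ) : ℕ := max 1 ⌈Real.logb 2 (n / ε)⌉₊

/-- There are one program and one constant `C` such that, for all `n ≥ 1` and all real `ε` with
`0 < ε ≤ 1`, the program, on input `n` and `⌈1 / ε⌉`, computes the mantissa (register `0`) and the
exponent (register `1`) of a floating-point number `Z = mantissa * 2 ^ exponent` with
`(1 - ε) f(n) ≤ Z ≤ f(n)`, where the mantissa and the exponent together have at most
`C log (n / ε)` bits, in time at most `C n ^ 3 log (n / ε) M(log (n / ε))`. -/
def HasFastApproxCounter (mulCost : ℕ → ℕ) (M : ℕ → ℝ) (f : ℕ → ℕ) : Prop :=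
  ∃ (p : RamProg) (C : ℝ), ∀ (n : ℕ) (ε : ℝ), 1 ≤ n → 0 < ε → ε ≤ 1 →
    ∃ (c : ℕ) (τ : RamState),
      RamExec mulCost p (RamState.init n ⌈1 / ε⌉₊) c τ ∧
      ((Nat.size (τ.reg 0) + Nat.size (τ.reg 1) : ℕ) : ℝ) ≤ C * (logRatio n ε : ℝ) ∧
      (1 - ε) * (f n : ℝ) ≤ (τ.reg 0 : ℝ) * 2 ^ (τ.reg 1) ∧
      (τ.reg 0 : ℝ) * 2 ^ (τ.reg 1) ≤ (f n : ℝ) ∧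
      (c : ℝ) ≤ C * ((n : ℝ) ^ 3 * (logRatio n ε : ℝ) * M (logRatio n ε))

/-! Deleting a sink gives a recurrence. Let `R` have sink set `K ∪ {v}`, with `v ∉ K`, and let `S`
be the sink set of what remains after deleting `v`. The in-neighbourhood `I` of `v` must satisfy `S
\ I = K`, so it is prescribed on `S` and free on the `p'` non-sinks: `2 ^ p'` choices. In the
essential and extensional families some choices are forbidden (`mem_addSink`). Their number depends
only on the number of vertices, `p'` and `i = #(S \ K)`, and is the same for all `i ≥ 2`
(`card_forb`). Hence the number `nsink t m p` of members with a prescribed set of `p` non-sinks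
satisfies a binomial recurrence in `m` (`cnt_eq`), and a last binomial sum over sink sets gives the
family size (`card_mem`). Extensional digraphs are treated with all edges reversed.

Each level is a sum `∑ i, p.choose i * u i (p - i)`, needed for all `p ≤ m`. Since `u i = u 2` for
`i ≥ 2`, Pascal's rule computes all of these with three arrays and `O(m ^ 2)` additions
(`binSum_shiftSeq_succ`, `runs_triP`). The factors `2 ^ p' - g` cost one shift and at most `n`
additions each, for `O(n)` products per level. So `n` levels take `O(n ^ 3)` operations on
`O(L)`-bit numbers, up to constants, and no multiplication instruction is used.

All quantities are nonnegative and mantissas are truncated to `L` bits, so results are lower bounds,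
and each rounding step loses at most a factor `1 - 4 / 2 ^ L` (`Approx.add`, `Approx.scale`). The
budget after `m` levels is `m ^ 2`, and `(n + 1) ^ 2` at the end. By Bernoulli's inequality `L =
O(log (n / ε))` bits suffice. -/

namespace DagCount

open Finset

/-! ### Three digraph families and the attachment of a sink. -/

/-- The three families of digraphs that are counted. -/
inductive Family
  | all
  | essential
  | extensional

/-- Membership of a relation in a family; the extensional family is described by in-neighbours,
that is, up to reversal of all edges. -/
def Mem {V : Type} (t : Family) (R : V → V → Prop) : Prop :=
  (∀ v, ¬ Relation.TransGen R v v) ∧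
    match t with
    | .all => True
    | .essential => ∀ u v, R u v → ¬ ∀ w, R w u ↔ (R w v ∧ w ≠ u)
    | .extensional => ∀ u v, u ≠ v → ¬ ∀ w, R w u ↔ R w v

/-- The in-neighbourhoods which a new sink must not have. -/
def Forb {V : Type} (t : Family) (H : V → V → Prop) (I : Finset V) : Prop :=
  match t with
  | .all => False
  | .essential => ∃ u, ∀ w, w ∈ I ↔ (H w u ∨ w = u)
  | .extensional => ∃ u, ∀ w, w ∈ I ↔ H w u

/-- `K` is the set of sinks of `R`. -/
def IsSinks {V : Type} (R : V → V → Prop) (K : Finset V) : Prop :=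
  ∀ v, v ∈ K ↔ ∀ w, ¬ R v w

/-- Add a new sink with in-neighbourhood `I`. -/
def addSink {V : Type} (H : V → V → Prop) (I : Finset V) : Option V → Option V → Prop
  | some u, some w => H u w
  | some u, none => u ∈ I
  | none, _ => False

section addSink
variable {V : Type} (H : V → V → Prop) (I : Finset V)

@[simp] lemma addSink_some_some (u w : V) : addSink H I (some u) (some w) ↔ H u w := Iff.rfl
@[simp] lemma addSink_some_none (u : V) : addSink H I (some u) none ↔ u ∈ I := Iff.rfl
@[simp] lemma addSink_none (u : Option V) : addSink H I none u ↔ False := Iff.rfl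

/-- The new vertex has no out-edges, so a walk between old vertices never visits it. -/
lemma transGen_addSink {a b : V} (h : Relation.TransGen (addSink H I) (some a) (some b)) :
    Relation.TransGen H a b := by
  have key : ∀ c, Relation.TransGen (addSink H I) (some a) c →
      ∀ b, c = some b → Relation.TransGen H a b := by
    intro c hc
    induction hc with
    | single h => rintro b rfl; exact .single h
    | @tail c d _ h ih =>
      rintro b rfl
      cases c with
      | none => exact h.elim
      | some c => exact (ih c rfl).tail h
  exact key _ h b rfl

lemma acyclic_addSink :
    (∀ v, ¬ Relation.TransGen (addSink H I) v v) ↔ ∀ v, ¬ Relation.TransGen H v v := by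
  constructor
  · intro h v hv
    exact h (some v) (Relation.TransGen.lift (p := addSink H I) some (fun _ _ h => h) v v hv)
  · rintro h (_ | v) hv
    · obtain ⟨c, hc, -⟩ := Relation.TransGen.head'_iff.1 hv
      exact hc
    · exact h v (transGen_addSink H I hv)

/-- A new sink leaves the in-neighbourhoods of old vertices unchanged, so only pairs involving
`none` impose new conditions. In the essential case the edge from `u` to `none` is bad exactly when
`I` is the in-neighbourhood of `u` together with `u`; this uses that `H` has no loops. -/
lemma mem_addSink (t : Family) : Mem t (addSink H I) ↔ Mem t H ∧ ¬ Forb t H I := by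
  unfold Mem
  rw [acyclic_addSink, and_assoc]
  refine and_congr_right fun hac => ?_
  have irr : ∀ u, ¬ H u u := fun u hu => hac u (.single hu)
  cases t with
  | all => simp [Forb]
  | essential =>
    simp only [Forb]
    constructor
    · intro h
      refine ⟨fun u v huv hw => h (some u) (some v) huv ?_, ?_⟩
      · rintro (_ | w)
        · simp
        · simpa using hw w
      · rintro ⟨u, hu⟩
        refine h (some u) none ((hu u).2 (.inr rfl)) ?_
        rintro (_ | w)
        · simp
        · have := irr w
          have := hu w
          simp only [addSink_some_some, addSink_some_none, ne_eq, Option.some.injEq]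
          grind
    · rintro ⟨h1, h2⟩ (_ | u) (_ | v) huv hw
      · exact huv
      · exact huv
      · refine h2 ⟨u, fun w => ?_⟩
        have := hw (some w)
        have h3 : u ∈ I := huv
        simp only [addSink_some_some, addSink_some_none, ne_eq, Option.some.injEq] at this
        grind
      · refine h1 u v huv fun w => ?_
        simpa using hw (some w)
  | extensional =>
    simp only [Forb]
    constructor
    · intro h
      refine ⟨fun u v huv hw => h (some u) (some v) (by simpa using huv) ?_, ?_⟩
      · rintro (_ | w)
        · simp
        · simpa using hw w
      · rintro ⟨u, hu⟩
        refine h (some u) none (by simp) ?_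
        rintro (_ | w)
        · simp
        · simpa using (hu w).symm
    · rintro ⟨h1, h2⟩ (_ | u) (_ | v) huv hw
      · exact huv rfl
      · exact h2 ⟨v, fun w => by simpa using hw (some w)⟩
      · exact h2 ⟨u, fun w => by simpa using (hw (some w)).symm⟩
      · exact h1 u v (by simpa using huv) fun w => by simpa using hw (some w)

lemma isSinks_addSink (K : Finset V) :
    IsSinks (addSink H I) (insertNone K) ↔ ∀ u, u ∈ K ↔ (∀ w, ¬ H u w) ∧ u ∉ I := by
  unfold IsSinks
  constructor
  · intro h u
    have := h (some u)
    simp only [some_mem_insertNone, Option.forall, addSink_some_some, addSink_some_none] at this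
    tauto
  · rintro h (_ | u)
    · simp
    · have := h u
      simp only [some_mem_insertNone, Option.forall, addSink_some_some, addSink_some_none]
      tauto

end addSink

/-! ### Counting the admissible in-neighbourhoods of a new sink. -/

/-- The correction for in-neighbourhoods of size `0` on the sinks. -/
def gam : Family → ℕ → ℕ → ℕ
  | .all, _, _ => 0
  | .essential, _, p => p
  | .extensional, m, _ => m

/-- The correction for in-neighbourhoods with exactly one sink. -/
def bet : Family → ℕ
  | .essential => 1
  | _ => 0

/-- The number of forbidden in-neighbourhoods which contain `i` prescribed sinks and
otherwise only non-sinks, where there are `m` vertices, `p` of them non-sinks. -/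
def corr (t : Family) (m p i : ℕ) : ℕ :=
  if i = 0 then gam t m p else if i = 1 then bet t else 0

section attach
variable {V : Type} [Fintype V]

open Classical in
-- The condition forces `I ∩ S = S \ K` and leaves `I` free outside `S`.
lemma card_trace (K S : Finset V) (h : K ⊆ S) :
    #{I : Finset V | ∀ u, u ∈ K ↔ u ∈ S ∧ u ∉ I} = 2 ^ #(Sᶜ) := by
  rw [← card_powerset]
  refine card_bij' (fun I _ => I \ S) (fun J _ => J ∪ (S \ K)) ?_ ?_ ?_ ?_
  · intro I hI
    simp only [mem_powerset]
    intro x; simp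
  · intro J hJ
    simp only [mem_filter, mem_univ, true_and]
    intro u
    have h1 := @h u
    have h2 := mem_powerset.1 hJ
    replace h2 := @h2 u
    simp only [mem_compl] at h2
    simp only [mem_union, mem_sdiff]
    tauto
  · intro I hI
    simp only [mem_filter, mem_univ, true_and] at hI
    ext u
    have h1 := hI u
    simp only [mem_union, mem_sdiff]
    tauto
  · intro J hJ
    ext u
    have h2 := mem_powerset.1 hJ
    replace h2 := @h2 u
    simp only [mem_compl] at h2
    simp only [mem_union, mem_sdiff]
    tauto

open Classical in
-- Forbidden sets are indexed injectively by vertices `x`, and in-neighbourhoods contain no sinks.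
-- So the trace of a forbidden set on `S` is `S ∩ {x}` in the essential case and empty in the
-- extensional case; it remains to count the `x` whose trace is `S \ K`.
lemma card_forb (t : Family) (H : V → V → Prop) (hH : Mem t H) (K S : Finset V) (hS : IsSinks H S)
    (h : K ⊆ S) :
    #{I : Finset V | (∀ u, u ∈ K ↔ u ∈ S ∧ u ∉ I) ∧ Forb t H I} =
      corr t (Fintype.card V) #(Sᶜ) #(S \ K) := by
  obtain ⟨hac, hH⟩ := hH
  have irr : ∀ u, ¬ H u u := fun u hu => hac u (.single hu)
  cases t with
  | all => simp [Forb, corr, gam, bet]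
  | essential =>
    let nb : V → Finset V := fun u => univ.filter fun w => H w u ∨ w = u
    -- Equal closed in-neighbourhoods of distinct `u`, `v` would give edges in both directions,
    -- hence a closed walk.
    have hnb : Function.Injective nb := by
      intro u v huv
      by_contra hne
      have h1 : u ∈ nb v := huv ▸ by simp [nb]
      have h2 : v ∈ nb u := huv ▸ by simp [nb]
      simp only [nb, mem_filter, mem_univ, true_and] at h1 h2
      have h3 : H u v := h1.resolve_right hne
      have h4 : H v u := h2.resolve_right (Ne.symm hne)
      exact hac u ((Relation.TransGen.single h3).tail h4)
    have himg : ({I : Finset V | (∀ u, u ∈ K ↔ u ∈ S ∧ u ∉ I) ∧ Forb .essential H I}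
        : Finset (Finset V)) =
        ({x : V | ∀ u, u ∈ S \ K ↔ u ∈ S ∧ u = x} : Finset V).map ⟨nb, hnb⟩ := by
      ext I
      simp only [mem_filter, mem_univ, true_and, mem_map, Function.Embedding.coeFn_mk,
        mem_sdiff]
      simp only [Forb]
      constructor
      · rintro ⟨h1, x, hx⟩
        refine ⟨x, fun u => ?_, ?_⟩
        · have := h1 u
          have := hx u
          have := hS u
          have := @h u
          grind
        · ext w; simp [nb, hx]
      · rintro ⟨x, hx, rfl⟩
        refine ⟨fun u => ?_, x, by simp [nb]⟩
        have := hx u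
        have := hS u
        have := @h u
        simp only [nb, mem_filter, mem_univ, true_and]
        grind
    rw [himg, card_map]
    simp only [corr, gam, bet]
    split_ifs with h0 h1
    · congr 1
      rw [card_eq_zero] at h0
      ext x
      simp only [h0, mem_filter, mem_univ, true_and, notMem_empty, false_iff, mem_compl]
      constructor
      · intro h hx; exact h x ⟨hx, rfl⟩
      · rintro h u ⟨hu, rfl⟩; exact h hu
    · obtain ⟨y, hy⟩ := card_eq_one.1 h1
      rw [card_eq_one]
      refine ⟨y, ?_⟩
      have hyS : y ∈ S := (mem_sdiff.1 (hy ▸ mem_singleton_self y)).1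
      ext x
      simp only [hy, mem_filter, mem_univ, true_and, mem_singleton]
      constructor
      · intro h; exact ((h y).1 rfl).2.symm
      · rintro rfl u
        constructor
        · rintro rfl; exact ⟨hyS, rfl⟩
        · exact fun h => h.2
    · rw [card_eq_zero, filter_eq_empty_iff]
      intro x _ hx
      have : S \ K ⊆ {x} := fun u hu => by simpa using ((hx u).1 hu).2
      have := card_le_card this
      simp only [card_singleton] at this
      omega
  | extensional =>
    let nb : V → Finset V := fun u => univ.filter fun w => H w u
    -- Here injectivity is extensionality of `H` itself.
    have hnb : Function.Injective nb := by
      intro u v huv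
      by_contra hne
      refine hH u v hne fun w => ?_
      have := congrArg (w ∈ ·) huv
      simpa [nb] using this
    have himg : ({I : Finset V | (∀ u, u ∈ K ↔ u ∈ S ∧ u ∉ I) ∧ Forb .extensional H I}
        : Finset (Finset V)) =
        ({x : V | S \ K = ∅} : Finset V).map ⟨nb, hnb⟩ := by
      ext I
      simp only [mem_filter, mem_univ, true_and, mem_map, Function.Embedding.coeFn_mk,
        sdiff_eq_empty_iff_subset]
      simp only [Forb]
      constructor
      · rintro ⟨h1, x, hx⟩
        refine ⟨x, fun u => ?_, ?_⟩
        · have := h1 u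
          have := hx u
          have := hS u
          grind
        · ext w; simp [nb, hx]
      · rintro ⟨x, hx, rfl⟩
        refine ⟨fun u => ?_, x, by simp [nb]⟩
        have := @hx u
        have := hS u
        have := @h u
        simp only [nb, mem_filter, mem_univ, true_and]
        grind
    rw [himg, card_map]
    simp only [corr, gam, bet, card_eq_zero]
    split_ifs with h0
    · simp [h0]
    · simp [h0]
    · simp [h0]

open Classical in
-- Subtract the forbidden sets from all sets with the right trace. Both are cardinalities of actual
-- sets, one inside the other, so the natural subtraction is not truncated here.
lemma card_attach (t : Family) (H : V → V → Prop) (hH : Mem t H) (K S : Finset V)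
    (hS : IsSinks H S) :
    Nat.card {I : Finset V // ¬ Forb t H I ∧ ∀ u, u ∈ K ↔ u ∈ S ∧ u ∉ I} =
      if K ⊆ S then 2 ^ #(Sᶜ) - corr t (Fintype.card V) #(Sᶜ) #(S \ K) else 0 := by
  split_ifs with h
  · rw [← card_trace K S h, ← card_forb t H hH K S hS h, Nat.card_eq_fintype_card,
      Fintype.card_subtype]
    have := card_filter_add_card_filter_not
      (s := ({I : Finset V | ∀ u, u ∈ K ↔ u ∈ S ∧ u ∉ I} : Finset (Finset V)))
      (fun I => Forb t H I)
    rw [filter_filter, filter_filter] at this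
    simp only [and_comm (a := ¬ Forb t H _)]
    omega
  · rw [Nat.card_eq_zero]
    left
    constructor
    rintro ⟨I, -, hI⟩
    exact h fun u hu => ((hI u).1 hu).1

end attach


/-! ### Summation over the sink set left after deleting a sink. -/

/-- The number of relations of a family with a prescribed set of sinks. -/
noncomputable def cnt {V : Type} (t : Family) (K : Finset V) : ℕ :=
  Nat.card {R : V → V → Prop // Mem t R ∧ IsSinks R K}

lemma mem_equiv {V W : Type} (e : V ≃ W) (t : Family) (R : W → W → Prop) :
    Mem t (fun a b => R (e a) (e b)) ↔ Mem t R := by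
  have h1 : (∀ v, ¬ Relation.TransGen (fun a b => R (e a) (e b)) v v) ↔
      ∀ v, ¬ Relation.TransGen R v v := by
    constructor
    · intro h v hv
      refine h (e.symm v) (Relation.TransGen.lift (r := R) e.symm (fun a b hab => ?_) v v hv)
      simpa [Function.onFun] using hab
    · intro h v hv
      exact h (e v) (Relation.TransGen.lift (p := R) e (fun a b hab => hab) v v hv)
  unfold Mem
  rw [h1]
  refine and_congr_right fun _ => ?_
  cases t with
  | all => rfl
  | essential => simp only [← e.forall_congr_right (q := fun _ => _), ne_eq, e.apply_eq_iff_eq]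
  | extensional => simp only [← e.forall_congr_right (q := fun _ => _), ne_eq, e.apply_eq_iff_eq]

lemma cnt_equiv {V W : Type} (e : V ≃ W) (t : Family) (K : Finset V) :
    cnt t (K.map e.toEmbedding) = cnt t K := by
  refine Nat.card_congr ?_
  refine Equiv.subtypeEquiv
    ⟨fun R a b => R (e a) (e b), fun R a b => R (e.symm a) (e.symm b),
      fun R => by simp, fun R => by simp⟩ fun R => ?_
  refine and_congr (mem_equiv e t R).symm ?_
  unfold IsSinks
  rw [← e.forall_congr_right]
  refine forall_congr' fun v => ?_
  rw [← e.forall_congr_right]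
  simp

/-- Relations on `Option V` in which `none` is a sink are given by their restriction to `V` and
the in-neighbourhood of `none`. -/
lemma exists_addSink {V : Type} [Fintype V] (R : Option V → Option V → Prop)
    (hR : ∀ w, ¬ R none w) : ∃ H I, addSink H I = R := by
  classical
  refine ⟨fun a b => R (some a) (some b), univ.filter fun a => R (some a) none, ?_⟩
  ext (_ | a) (_ | b) <;> simp [hR]

lemma addSink_injective {V : Type} {H H' : V → V → Prop} {I I' : Finset V}
    (h : addSink H I = addSink H' I') : H = H' ∧ I = I' := by
  constructor
  · ext a b
    simpa using iff_of_eq (congrFun₂ h (some a) (some b))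
  · ext a
    simpa using iff_of_eq (congrFun₂ h (some a) none)

open Classical in
-- Relations with `none` as a sink correspond to pairs `(H, I)`. Grouping the `H` by their sink set
-- `S` makes the number of admissible `I` constant on each group.
lemma cnt_insertNone {V : Type} [Fintype V] (t : Family) (K : Finset V) :
    cnt t (insertNone K) = ∑ S : Finset V, cnt t S *
      if K ⊆ S then 2 ^ #(Sᶜ) - corr t (Fintype.card V) #(Sᶜ) #(S \ K) else 0 := by
  let sk : (V → V → Prop) → Finset V := fun H => univ.filter fun v => ∀ w, ¬ H v w
  have hsk : ∀ H S, IsSinks H S ↔ sk H = S := by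
    intro H S
    simp only [IsSinks, sk, Finset.ext_iff, mem_filter, mem_univ, true_and]
    exact forall_congr' fun v => Iff.comm
  have e : (Σ H : {H : V → V → Prop // Mem t H},
      {I : Finset V // ¬ Forb t H.1 I ∧ ∀ u, u ∈ K ↔ u ∈ sk H.1 ∧ u ∉ I}) ≃
      {R : Option V → Option V → Prop // Mem t R ∧ IsSinks R (insertNone K)} := by
    refine Equiv.ofBijective (fun x => ⟨addSink x.1.1 x.2.1, ?_, ?_⟩) ⟨?_, ?_⟩
    · exact (mem_addSink _ _ t).2 ⟨x.1.2, x.2.2.1⟩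
    · rw [isSinks_addSink]
      intro u
      rw [x.2.2.2 u]
      simp [sk]
    · rintro ⟨⟨H, hH⟩, I, hI⟩ ⟨⟨H', hH'⟩, I', hI'⟩ h
      obtain ⟨rfl, rfl⟩ := addSink_injective (congrArg Subtype.val h)
      rfl
    · rintro ⟨R, hR, hs⟩
      obtain ⟨H, I, rfl⟩ := exists_addSink R ((hs none).1 (by simp))
      rw [isSinks_addSink] at hs
      obtain ⟨h1, h2⟩ := (mem_addSink _ _ t).1 hR
      exact ⟨⟨⟨H, h1⟩, I, h2, fun u => by rw [hs u]; simp [sk]⟩, rfl⟩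
  rw [cnt, ← Nat.card_congr e, Nat.card_sigma,
    Finset.sum_congr rfl fun H _ => card_attach t H.1 H.2 K (sk H.1) ((hsk _ _).2 rfl),
    ← Finset.sum_fiberwise univ (fun H : {H : V → V → Prop // Mem t H} => sk H.1)]
  refine sum_congr rfl fun S _ => ?_
  rw [sum_congr rfl (g := fun _ => if K ⊆ S then
    2 ^ #(Sᶜ) - corr t (Fintype.card V) #(Sᶜ) #(S \ K) else 0)
    (fun H hH => by rw [(mem_filter.1 hH).2]), sum_const, smul_eq_mul]
  congr 1
  rw [cnt, ← Fintype.card_subtype, ← Nat.card_eq_fintype_card]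
  exact Nat.card_congr ((Equiv.subtypeSubtypeEquivSubtypeInter (Mem t)
    (fun H => sk H = S)).trans (Equiv.subtypeEquivRight fun H => by rw [hsk]))

/-! ### The binomial recurrence for the number of non-sinks. -/

/-- `binSum r u p` is the sum of `u i (p - i)` with binomial weights. -/
def binSum (r : ℕ) (u : ℕ → ℕ → ℕ) (p : ℕ) : ℕ :=
  ∑ i ∈ range (r + 1), r.choose i * u i (p - i)

@[simp] lemma binSum_zero (u : ℕ → ℕ → ℕ) (p : ℕ) : binSum 0 u p = u 0 p := by
  simp [binSum]

/-- Pascal's rule: the second summand collects the terms with index raised by one, which shifts `u`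
and lowers `p`. -/
lemma binSum_succ (r : ℕ) (u : ℕ → ℕ → ℕ) (p : ℕ) :
    binSum (r + 1) u p = binSum r u p + binSum r (fun i => u (i + 1)) (p - 1) := by
  unfold binSum
  rw [sum_range_succ' _ (r + 1)]
  simp only [Nat.choose_succ_succ, add_mul, sum_add_distrib, Nat.sub_sub, Nat.add_comm 1]
  rw [sum_range_succ (fun i => r.choose (i + 1) * _) r,
    sum_range_succ' (fun i => r.choose i * u i (p - i)) r]
  simp
  ring

/-- `nsink t m p` is the number of members of the family `t` on `m` vertices of which a prescribed
set of `p` vertices is the set of the non-sinks. -/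
def nsink (t : Family) : ℕ → ℕ → ℕ
  | 0, p => if p = 0 then 1 else 0
  | m + 1, p =>
    if p ≤ m then binSum p (fun i p' => (2 ^ p' - corr t m p' i) * nsink t m p') p else 0

/-- A finite nonempty acyclic relation has a sink, namely a minimal element for the transitive
closure of the reversed relation. -/
lemma cnt_empty {V : Type} [Finite V] [Nonempty V] (t : Family) : cnt t (∅ : Finset V) = 0 := by
  unfold cnt
  rw [Nat.card_eq_zero]
  left
  constructor
  rintro ⟨R, ⟨hac, -⟩, hs⟩
  have : Std.Irrefl (Relation.TransGen (flip R)) := ⟨fun a h => hac a (by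
    rw [← Relation.transGen_swap] at h; exact h)⟩
  have wf : WellFounded (Relation.TransGen (flip R)) :=
    Finite.wellFounded_of_trans_of_irrefl _
  obtain ⟨v, -, hv⟩ := wf.has_min Set.univ Set.univ_nonempty
  exact absurd ((hs v).2 fun w h => hv w trivial (.single h)) (by simp)

/-- Write `S = K ∪ A` with `A ⊆ Kᶜ`. By the induction hypothesis the summand depends only on `#A`,
so the sum over `A` becomes binomial. -/
lemma cnt_insertNone_eq (t : Family) {m : ℕ} {V : Type} [Fintype V] (hV : Fintype.card V = m)
    (ih : ∀ S : Finset V, cnt t S = nsink t m (m - #S)) (K : Finset V) :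
    cnt t (insertNone K) = nsink t (m + 1) (m - #K) := by
  classical
  have hKm : #K ≤ m := hV ▸ card_le_univ K
  rw [cnt_insertNone, hV]
  set p := m - #K with hp
  have hpc : #(Kᶜ) = p := by rw [card_compl, hV]
  simp only [nsink, if_pos (show p ≤ m by omega), binSum, mul_ite, mul_zero]
  rw [← sum_filter]
  have h1 := sum_powerset_apply_card (fun i => (2 ^ (p - i) - corr t m (p - i) i) *
    nsink t m (p - i)) (x := Kᶜ)
  rw [hpc] at h1
  simp only [smul_eq_mul] at h1
  rw [← h1]
  refine sum_bij' (fun S _ => S \ K) (fun A _ => K ∪ A) ?_ ?_ ?_ ?_ ?_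
  · intro S _
    rw [mem_powerset]
    intro x; simp
  · intro A _; simp
  · intro S hS
    exact union_sdiff_of_subset (mem_filter.1 hS).2
  · intro A hA
    refine union_sdiff_cancel_left ?_
    rw [mem_powerset, subset_compl_iff_disjoint_left] at hA
    exact hA
  · intro S hS
    have h2 := (mem_filter.1 hS).2
    have h3 := card_sdiff_add_card_eq_card h2
    have h4 : #S ≤ m := hV ▸ card_le_univ S
    have h5 : #(Sᶜ) = m - #S := by rw [card_compl, hV]
    have h6 : p - #(S \ K) = m - #S := by omega
    rw [ih S, mul_comm, h6]
    convert rfl using 4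
    · exact h5.symm
    · convert h5.symm

/-- Induction on the number of vertices: any vertex of `K` can play the role of `none`. An empty `K`
on `m + 1` vertices means `p = m + 1 > m`, where `nsink` takes its default value `0`, in agreement
with `cnt_empty`. -/
lemma cnt_eq (t : Family) (n : ℕ) : ∀ (V : Type) [Fintype V], Fintype.card V = n →
    ∀ K : Finset V, cnt t K = nsink t n (n - #K) := by
  classical
  induction n with
  | zero =>
    intro V _ hV K
    have := Fintype.card_eq_zero_iff.1 hV
    simp only [nsink, zero_tsub, if_true]
    unfold cnt
    rw [Nat.card_eq_one_iff_unique]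
    refine ⟨⟨fun a b => Subtype.ext (Subsingleton.elim _ _)⟩, ⟨fun _ _ => False, ⟨?_, ?_⟩, ?_⟩⟩
    · intro v; exact isEmptyElim v
    · cases t with
      | all => trivial
      | essential => intro v; exact isEmptyElim v
      | extensional => intro v; exact isEmptyElim v
    · intro v; exact isEmptyElim v
  | succ m ih =>
    intro V _ hV K
    rcases K.eq_empty_or_nonempty with rfl | ⟨v, hv⟩
    · have : Nonempty V := Fintype.card_pos_iff.1 (by omega)
      rw [cnt_empty]
      simp [nsink]
    · let e : Option {x : V // x ≠ v} ≃ V := Equiv.optionSubtypeNe v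
      have hW : Fintype.card {x : V // x ≠ v} = m := by
        have := Fintype.card_congr e
        rw [Fintype.card_option] at this
        omega
      let K' : Finset {x : V // x ≠ v} := K.subtype _
      have hK : (insertNone K').map e.toEmbedding = K := by
        ext x
        simp only [mem_map_equiv]
        by_cases hx : x = v
        · subst hx
          have : e.symm x = none := by rw [Equiv.symm_apply_eq]; rfl
          simp [this, hv]
        · have : e.symm x = some ⟨x, hx⟩ := by rw [Equiv.symm_apply_eq]; rfl
          rw [this, some_mem_insertNone]
          exact mem_subtype
      have hcard : #K = #K' + 1 := by rw [← hK, card_map, card_insertNone]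
      rw [hcard, ← hK, cnt_equiv, cnt_insertNone_eq t hW (ih _ hW), Nat.add_sub_add_right]

lemma card_mem (t : Family) (n : ℕ) (V : Type) [Fintype V] (hV : Fintype.card V = n) :
    Nat.card {R : V → V → Prop // Mem t R} = binSum n (fun _ p => nsink t n p) n := by
  classical
  let sk : (V → V → Prop) → Finset V := fun H => univ.filter fun v => ∀ w, ¬ H v w
  have hsk : ∀ H S, IsSinks H S ↔ sk H = S := by
    intro H S
    simp only [IsSinks, sk, Finset.ext_iff, mem_filter, mem_univ, true_and]
    exact forall_congr' fun v => Iff.comm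
  have e := Nat.card_congr (Equiv.sigmaFiberEquiv fun H : {R : V → V → Prop // Mem t R} => sk H.1)
  rw [← e, Nat.card_sigma]
  have h1 := sum_powerset_apply_card (fun i => nsink t n (n - i)) (x := (univ : Finset V))
  rw [card_univ, hV] at h1
  simp only [smul_eq_mul, powerset_univ] at h1
  rw [binSum, ← h1]
  refine sum_congr rfl fun S _ => ?_
  rw [← cnt_eq t n V hV S, cnt]
  exact Nat.card_congr ((Equiv.subtypeSubtypeEquivSubtypeInter (Mem t)
    (fun H => sk H = S)).trans (Equiv.subtypeEquivRight fun H => by rw [hsk]))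

/-- The number of members of a family on `n` labelled vertices. -/
def familyCount (t : Family) (n : ℕ) : ℕ := binSum n (fun _ p => nsink t n p) n

lemma numDAG_eq (n : ℕ) : numDAG n = familyCount .all n := by
  rw [familyCount, ← card_mem .all n (Fin n) (by simp)]
  refine Nat.card_congr (Equiv.subtypeEquiv
    ⟨fun D => D.Adj, fun R => ⟨R⟩, fun _ => rfl, fun _ => rfl⟩ fun D => ?_)
  simp [Mem, Digraph.IsDAG]

lemma numEssentialDAG_eq (n : ℕ) : numEssentialDAG n = familyCount .essential n := by
  rw [familyCount, ← card_mem .essential n (Fin n) (by simp)]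
  refine Nat.card_congr (Equiv.subtypeEquiv
    ⟨fun D => D.Adj, fun R => ⟨R⟩, fun _ => rfl, fun _ => rfl⟩ fun D => ?_)
  simp [Mem, Digraph.IsEssentialDAG, Digraph.IsDAG, Digraph.inNbrs, Set.ext_iff]

/-- Reversing all edges exchanges out- and in-neighbourhoods and preserves acyclicity. -/
lemma numExtensionalDAG_eq (n : ℕ) : numExtensionalDAG n = familyCount .extensional n := by
  rw [familyCount, ← card_mem .extensional n (Fin n) (by simp)]
  refine Nat.card_congr (Equiv.subtypeEquiv
    ⟨fun D a b => D.Adj b a, fun R => ⟨fun a b => R b a⟩, fun _ => rfl, fun _ => rfl⟩ fun D => ?_)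
  simp only [Mem, Digraph.IsExtensionalDAG, Digraph.IsDAG, Digraph.outNbrs, Equiv.coe_fn_mk]
  refine and_congr (forall_congr' fun v => not_congr ?_) (by simp [Set.ext_iff])
  exact (Relation.transGen_swap (r := D.Adj)).symm


/-! ### Truncating floating-point arithmetic. -/

/-- Truncate the mantissa of a floating-point number to `L` bits. -/
def normF (L : ℕ) (x : ℕ × ℕ) : ℕ × ℕ :=
  (x.1 / 2 ^ (Nat.size x.1 - L), x.2 + (Nat.size x.1 - L))

/-- Floating-point addition. -/
def addF (L : ℕ) (x y : ℕ × ℕ) : ℕ × ℕ :=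
  normF L (x.1 / 2 ^ (y.2 - x.2) + y.1 / 2 ^ (x.2 - y.2), x.2 + (y.2 - x.2))

/-- Floating-point multiplication by `2 ^ s - g`. -/
def scaleF (L s g : ℕ) (x : ℕ × ℕ) : ℕ × ℕ :=
  if 0 < (normF L (x.1 * 2 ^ s - g * x.1, x.2)).1 then normF L (x.1 * 2 ^ s - g * x.1, x.2)
  else ((normF L (x.1 * 2 ^ s - g * x.1, x.2)).1, 0)

/-- The floating-point number `x` with an `L`-bit mantissa approximates `v` from below, after
`k` roundings. -/
structure Approx (L k : ℕ) (x : ℕ × ℕ) (v : ℕ) : Prop where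
  lt : x.1 < 2 ^ L
  normal : x.2 = 0 ∨ 2 ^ (L - 1) ≤ x.1
  exp_le : x.2 ≤ k
  val_le : x.1 * 2 ^ x.2 ≤ v
  le_val : (1 - 4 / 2 ^ L : ℝ) ^ k * v ≤ x.1 * 2 ^ x.2

lemma two_div_pow {L : ℕ} (hL : 1 ≤ L) : (2 / 2 ^ L : ℝ) * 2 ^ (L - 1) = 1 := by
  obtain ⟨l, rfl⟩ := Nat.exists_eq_add_of_le' hL
  rw [pow_succ, Nat.add_sub_cancel]
  field_simp

lemma theta_nonneg {L : ℕ} (hL : 2 ≤ L) : (0 : ℝ) ≤ 1 - 4 / 2 ^ L := by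
  have : (4 : ℝ) ≤ 2 ^ L := by
    calc (4 : ℝ) = 2 ^ 2 := by norm_num
      _ ≤ 2 ^ L := pow_le_pow_right₀ (by norm_num) hL
  rw [sub_nonneg, div_le_one (by positivity)]
  exact this

lemma theta_le_one (L : ℕ) : (1 - 4 / 2 ^ L : ℝ) ≤ 1 := by
  have : (0 : ℝ) ≤ 4 / 2 ^ L := by positivity
  linarith

/-- The error of a truncation is small relative to a large enough number. -/
lemma sub_le_div_mul {L : ℕ} (hL : 1 ≤ L) (a b t : ℕ) (h : 2 ^ (L - 1 + t) ≤ b) :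
    (a : ℝ) - 2 / 2 ^ L * b ≤ ((a / 2 ^ t : ℕ) : ℝ) * 2 ^ t := by
  have h1 : a < (a / 2 ^ t + 1) * 2 ^ t := by
    have := Nat.lt_div_mul_add (a := a) (b := 2 ^ t) (by positivity)
    linarith [this]
  have h2 : (a : ℝ) ≤ (((a / 2 ^ t : ℕ) : ℝ) + 1) * 2 ^ t := by exact_mod_cast h1.le
  have h3 : (2 : ℝ) ^ (L - 1 + t) ≤ b := by exact_mod_cast h
  have h4 : (2 : ℝ) ^ t ≤ 2 / 2 ^ L * b := by
    calc (2 : ℝ) ^ t = 2 / 2 ^ L * 2 ^ (L - 1) * 2 ^ t := by rw [two_div_pow hL, one_mul]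
      _ = 2 / 2 ^ L * 2 ^ (L - 1 + t) := by rw [pow_add, mul_assoc]
      _ ≤ _ := by gcongr
  linarith

section normF
variable {L : ℕ} (x : ℕ × ℕ)

lemma normF_lt : (normF L x).1 < 2 ^ L := by
  unfold normF
  rw [Nat.div_lt_iff_lt_mul (by positivity), ← pow_add]
  exact (Nat.lt_size_self _).trans_le (Nat.pow_le_pow_right (by norm_num) (by omega))

/-- If any bit is dropped, exactly `L` significant bits remain. -/
lemma normF_normal (hL : 1 ≤ L) (h : x.2 = 0 ∨ 2 ^ (L - 1) ≤ x.1) :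
    (normF L x).2 = 0 ∨ 2 ^ (L - 1) ≤ (normF L x).1 := by
  unfold normF
  rcases Nat.eq_zero_or_pos (Nat.size x.1 - L) with h0 | h0
  · simpa [h0] using h
  · right
    rw [Nat.le_div_iff_mul_le (by positivity), ← pow_add]
    exact Nat.lt_size.1 (by omega)

lemma normF_val_le : (normF L x).1 * 2 ^ (normF L x).2 ≤ x.1 * 2 ^ x.2 := by
  unfold normF
  rw [pow_add, mul_comm (2 ^ x.2), ← mul_assoc]
  exact Nat.mul_le_mul_right _ (Nat.div_mul_le_self _ _)

lemma le_normF_val (hL : 1 ≤ L) :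
    (1 - 2 / 2 ^ L : ℝ) * (x.1 * 2 ^ x.2) ≤ (normF L x).1 * 2 ^ (normF L x).2 := by
  have key : (1 - 2 / 2 ^ L : ℝ) * x.1 ≤
      ((x.1 / 2 ^ (Nat.size x.1 - L) : ℕ) : ℝ) * 2 ^ (Nat.size x.1 - L) := by
    rcases Nat.eq_zero_or_pos (Nat.size x.1 - L) with h0 | h0
    · have : (0 : ℝ) ≤ 2 / 2 ^ L * x.1 := by positivity
      simp only [h0, pow_zero, Nat.div_one, mul_one]
      linarith
    · have := sub_le_div_mul hL x.1 x.1 (Nat.size x.1 - L) (Nat.lt_size.1 (by omega))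
      linarith
  unfold normF
  calc _ = (1 - 2 / 2 ^ L : ℝ) * x.1 * 2 ^ x.2 := by ring
    _ ≤ _ := mul_le_mul_of_nonneg_right key (by positivity)
    _ = _ := by rw [pow_add]; ring

end normF

lemma addF_comm (L : ℕ) (x y : ℕ × ℕ) : addF L x y = addF L y x := by
  unfold addF
  rw [add_comm (x.1 / _), show x.2 + (y.2 - x.2) = y.2 + (x.2 - y.2) by omega]

lemma Approx.mono {L k k' : ℕ} (hL : 2 ≤ L) {x : ℕ × ℕ} {v : ℕ} (h : Approx L k x v)
    (hk : k ≤ k') : Approx L k' x v where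
  lt := h.lt
  normal := h.normal
  exp_le := h.exp_le.trans hk
  val_le := h.val_le
  le_val := (mul_le_mul_of_nonneg_right
    (pow_le_pow_of_le_one (theta_nonneg hL) (theta_le_one L) hk) (Nat.cast_nonneg _)).trans h.le_val

/-- Two truncations occur, aligning the exponents and renormalising. Each costs a factor `1 - 2 / 2
^ L`, and their product is at least `1 - 4 / 2 ^ L`. Errors of the operands do not accumulate, since
both are relative and of the same sign. -/
lemma Approx.add {L k : ℕ} (hL : 2 ≤ L) {x y : ℕ × ℕ} {v w : ℕ} (hx : Approx L k x v)
    (hy : Approx L k y w) : Approx L (k + 1) (addF L x y) (v + w) := by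
  wlog hyx : y.2 ≤ x.2 generalizing x y v w
  · rw [addF_comm, add_comm v]
    exact this hy hx (by omega)
  have hL1 : 1 ≤ L := by omega
  obtain ⟨d, hd⟩ := Nat.exists_eq_add_of_le hyx
  set z : ℕ × ℕ := (x.1 + y.1 / 2 ^ d, x.2) with hz
  have hadd : addF L x y = normF L z := by
    unfold addF
    rw [show y.2 - x.2 = 0 by omega, show x.2 - y.2 = d by omega]
    simp [hz]
  have hz1 : z.1 < 2 ^ (L + 1) := by
    have := Nat.div_le_self y.1 (2 ^ d)
    have h1 := hx.lt
    have h2 := hy.lt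
    rw [pow_succ]
    simp only [hz]
    omega
  have hzu : z.1 * 2 ^ z.2 ≤ v + w := by
    have h1 : y.1 / 2 ^ d * 2 ^ x.2 ≤ y.1 * 2 ^ y.2 := by
      rw [hd, pow_add, mul_comm (2 ^ y.2), ← mul_assoc]
      exact Nat.mul_le_mul_right _ (Nat.div_mul_le_self _ _)
    simp only [hz, add_mul]
    exact add_le_add hx.val_le (h1.trans hy.val_le)
  have hzl : (1 - 2 / 2 ^ L : ℝ) * (x.1 * 2 ^ x.2 + y.1 * 2 ^ y.2) ≤ z.1 * 2 ^ z.2 := by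
    -- If `d > 0`, the exponent of `x` is positive, so its mantissa has its leading bit at position
    -- `L - 1`, and the `d` bits dropped from `y` are small relative to the sum.
    have key : (y.1 : ℝ) - 2 / 2 ^ L * (x.1 * 2 ^ d + y.1 : ℕ) ≤
        ((y.1 / 2 ^ d : ℕ) : ℝ) * 2 ^ d := by
      rcases Nat.eq_zero_or_pos d with h0 | h0
      · have : (0 : ℝ) ≤ 2 / 2 ^ L * (x.1 * 2 ^ d + y.1 : ℕ) := by positivity
        subst h0
        simp only [pow_zero, Nat.div_one, mul_one]
        simpa using this
      · refine sub_le_div_mul hL1 _ _ _ ?_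
        have := hx.normal.resolve_left (by omega)
        rw [pow_add]
        exact (Nat.mul_le_mul_right _ this).trans (Nat.le_add_right _ _)
    simp only [hz]
    push_cast at key ⊢
    calc _ = ((x.1 : ℝ) * 2 ^ d + (y.1 - 2 / 2 ^ L * (x.1 * 2 ^ d + y.1))) * 2 ^ y.2 := by
          rw [hd, pow_add]; ring
      _ ≤ ((x.1 : ℝ) * 2 ^ d + (y.1 / 2 ^ d : ℕ) * 2 ^ d) * 2 ^ y.2 := by gcongr
      _ = _ := by rw [hd, pow_add]; ring
  rw [hadd]
  refine ⟨normF_lt z, normF_normal z hL1 ?_, ?_, (normF_val_le z).trans hzu, ?_⟩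
  · exact hx.normal.imp_right fun h => h.trans (Nat.le_add_right _ _)
  · have : Nat.size z.1 ≤ L + 1 := Nat.size_le.2 hz1
    have := hx.exp_le
    have hz2 : z.2 = x.2 := rfl
    change z.2 + (Nat.size z.1 - L) ≤ k + 1
    omega
  · have h0 := theta_nonneg hL
    have h1 : (0 : ℝ) ≤ 1 - 2 / 2 ^ L := by
      have : (0 : ℝ) ≤ 2 / 2 ^ L := by positivity
      have h4 : (4 / 2 ^ L : ℝ) = 2 / 2 ^ L + 2 / 2 ^ L := by ring
      linarith
    calc (1 - 4 / 2 ^ L : ℝ) ^ (k + 1) * ((v + w : ℕ) : ℝ)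
        = (1 - 4 / 2 ^ L) * ((1 - 4 / 2 ^ L : ℝ) ^ k * v + (1 - 4 / 2 ^ L : ℝ) ^ k * w) := by
          push_cast; ring
      _ ≤ (1 - 4 / 2 ^ L) * (x.1 * 2 ^ x.2 + y.1 * 2 ^ y.2) :=
          mul_le_mul_of_nonneg_left (add_le_add hx.le_val hy.le_val) h0
      _ ≤ (1 - 2 / 2 ^ L) * (1 - 2 / 2 ^ L) * (x.1 * 2 ^ x.2 + y.1 * 2 ^ y.2) := by
          refine mul_le_mul_of_nonneg_right ?_ (by positivity)
          have : (0 : ℝ) ≤ (2 / 2 ^ L) ^ 2 := by positivity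
          have h4 : (4 / 2 ^ L : ℝ) = 2 * (2 / 2 ^ L) := by ring
          rw [h4]
          nlinarith
      _ = (1 - 2 / 2 ^ L) * ((1 - 2 / 2 ^ L) * (x.1 * 2 ^ x.2 + y.1 * 2 ^ y.2)) := by ring
      _ ≤ (1 - 2 / 2 ^ L) * (z.1 * 2 ^ z.2) := mul_le_mul_of_nonneg_left hzl h1
      _ ≤ _ := le_normF_val z hL1

/-- There is only one truncation, because the factor `2 ^ s - g` is applied exactly. The budget
nevertheless grows by `s + 1`, since it also bounds the exponent, which can grow by `s`. -/
lemma Approx.scale {L k : ℕ} (hL : 2 ≤ L) {x : ℕ × ℕ} {v : ℕ} (hx : Approx L k x v) (s g : ℕ) :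
    Approx L (k + s + 1) (scaleF L s g x) ((2 ^ s - g) * v) := by
  have hL1 : 1 ≤ L := by omega
  set c := 2 ^ s - g with hc
  have hcs : c ≤ 2 ^ s := Nat.sub_le _ _
  set z : ℕ × ℕ := (x.1 * c, x.2) with hz
  have hzz : (x.1 * 2 ^ s - g * x.1, x.2) = z := by
    rw [hz, hc, Nat.mul_sub, mul_comm g]
  have hsc : scaleF L s g x = if 0 < (normF L z).1 then normF L z else ((normF L z).1, 0) := by
    rw [scaleF, hzz]
  have h0 := theta_nonneg hL
  have hlow : (1 - 4 / 2 ^ L : ℝ) ^ (k + s + 1) * ((c * v : ℕ) : ℝ) ≤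
      (normF L z).1 * 2 ^ (normF L z).2 := by
    calc (1 - 4 / 2 ^ L : ℝ) ^ (k + s + 1) * ((c * v : ℕ) : ℝ)
        ≤ (1 - 4 / 2 ^ L : ℝ) ^ (k + 1) * ((c * v : ℕ) : ℝ) :=
          mul_le_mul_of_nonneg_right
            (pow_le_pow_of_le_one h0 (theta_le_one L) (by omega)) (Nat.cast_nonneg _)
      _ = (1 - 4 / 2 ^ L : ℝ) * (c * ((1 - 4 / 2 ^ L : ℝ) ^ k * v)) := by push_cast; ring
      _ ≤ (1 - 4 / 2 ^ L : ℝ) * (c * (x.1 * 2 ^ x.2)) := by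
          have := hx.le_val
          gcongr
      _ ≤ (1 - 2 / 2 ^ L : ℝ) * (c * (x.1 * 2 ^ x.2)) := by
          refine mul_le_mul_of_nonneg_right ?_ (by positivity)
          have : (2 : ℝ) / 2 ^ L ≤ 4 / 2 ^ L := by gcongr; norm_num
          linarith
      _ = (1 - 2 / 2 ^ L : ℝ) * (z.1 * 2 ^ z.2) := by simp only [hz]; push_cast; ring
      _ ≤ _ := le_normF_val z hL1
  have hup : (normF L z).1 * 2 ^ (normF L z).2 ≤ c * v := by
    refine (normF_val_le z).trans ?_
    simp only [hz]
    calc x.1 * c * 2 ^ x.2 = c * (x.1 * 2 ^ x.2) := by ring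
      _ ≤ _ := Nat.mul_le_mul_left _ hx.val_le
  rw [hsc]
  split_ifs with hpos
  · refine ⟨normF_lt z, normF_normal z hL1 ?_, ?_, hup, hlow⟩
    · refine hx.normal.imp_right fun h => ?_
      have : c ≠ 0 := by
        intro h0
        simp [normF, hz, h0] at hpos
      exact h.trans (Nat.le_mul_of_pos_right _ (by omega))
    · have : z.1 < 2 ^ (L + s) := by
        rw [pow_add]
        exact (Nat.mul_le_mul_left _ hcs).trans_lt
          ((Nat.mul_lt_mul_right (by positivity)).2 hx.lt)
      have := Nat.size_le.2 this
      have := hx.exp_le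
      simp only [normF, hz] at *
      omega
  -- A zero mantissa cannot satisfy the second alternative of `normal`, which is why `scaleF` resets
  -- the exponent.
  · have h1 : (normF L z).1 = 0 := by omega
    rw [h1] at hlow ⊢
    refine ⟨by positivity, .inl rfl, by simp, by simp, by simpa using hlow⟩

lemma approx_zero (L k : ℕ) : Approx L k (0, 0) 0 := by
  constructor <;> simp

lemma approx_one {L : ℕ} (hL : 1 ≤ L) : Approx L 0 (1, 0) 1 := by
  constructor <;> simp; omega


/-! ### Running-time rules for programs. -/

/-- The program `p`, started in `σ`, halts in `τ` after time at most `N`. -/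
def Runs (mc : ℕ → ℕ) (p : RamProg) (σ : RamState) (N : ℕ) (τ : RamState) : Prop :=
  ∃ c ≤ N, RamExec mc p σ c τ

section Runs
variable {mc : ℕ → ℕ}

lemma Runs.mono {p : RamProg} {σ τ : RamState} {N N' : ℕ} (h : Runs mc p σ N τ) (hN : N ≤ N') :
    Runs mc p σ N' τ :=
  let ⟨c, hc, h⟩ := h
  ⟨c, hc.trans hN, h⟩

lemma Runs.seq {p q : RamProg} {σ τ υ : RamState} {N N' : ℕ} (h : Runs mc p σ N τ)
    (h' : Runs mc q τ N' υ) : Runs mc (.seq p q) σ (N + N') υ :=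
  let ⟨_, hc, h⟩ := h
  let ⟨_, hc', h'⟩ := h'
  ⟨_, add_le_add hc hc', h.seq h'⟩

lemma size_le_of_lt {a S : ℕ} (h : a < 2 ^ S) : Nat.size a ≤ S := Nat.size_le.2 h

lemma testCost_le {σ : RamState} {x y S : ℕ} (hx : σ.reg x < 2 ^ S) (hy : σ.reg y < 2 ^ S) :
    σ.testCost x y ≤ 1 + 2 * S := by
  have := size_le_of_lt hx
  have := size_le_of_lt hy
  unfold RamState.testCost
  omega

/-- The invariant is indexed by the number of completed passes; the induction is on the number of
passes left. -/
lemma Runs.loop {x y : ℕ} {p : RamProg} (Inv : ℕ → RamState → Prop) {S T N : ℕ}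
    (hsmall : ∀ k ≤ N, ∀ σ, Inv k σ → σ.reg x < 2 ^ S ∧ σ.reg y < 2 ^ S)
    (hstep : ∀ k < N, ∀ σ, Inv k σ → σ.reg x < σ.reg y ∧ ∃ τ, Runs mc p σ T τ ∧ Inv (k + 1) τ)
    (hend : ∀ σ, Inv N σ → σ.reg y ≤ σ.reg x) (σ : RamState) (h0 : Inv 0 σ) :
    ∃ τ, Runs mc (.loop x y p) σ (N * (1 + 2 * S + T) + (1 + 2 * S)) τ ∧ Inv N τ := by
  have key : ∀ d k σ, k + d = N → Inv k σ →
      ∃ τ, Runs mc (.loop x y p) σ (d * (1 + 2 * S + T) + (1 + 2 * S)) τ ∧ Inv N τ := by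
    intro d
    induction d with
    | zero =>
      rintro k σ rfl h
      obtain ⟨h1, h2⟩ := hsmall _ le_rfl σ h
      exact ⟨σ, ⟨_, by simpa using testCost_le h1 h2, .loopFalse (by simpa using hend σ h)⟩, h⟩
    | succ d ih =>
      intro k σ hk h
      obtain ⟨h1, h2⟩ := hsmall k (by omega) σ h
      obtain ⟨hlt, τ, ⟨c, hc, hτ⟩, hinv⟩ := hstep k (by omega) σ h
      obtain ⟨υ, ⟨c', hc', hυ⟩, hinv'⟩ := ih (k + 1) τ (by omega) hinv
      have := testCost_le h1 h2
      refine ⟨υ, ⟨_, ?_, .loopTrue hlt hτ hυ⟩, hinv'⟩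
      calc σ.testCost x y + c + c' ≤ (1 + 2 * S) + T + (d * (1 + 2 * S + T) + (1 + 2 * S)) := by
            omega
        _ = _ := by ring
  exact key N 0 σ (by omega) h0

/-- A sequence of instructions. -/
def block : List RamInstr → RamProg
  | [] => .skip
  | i :: l => .seq (.instr i) (block l)

/-- The effect of a sequence of instructions. -/
def evalL : List RamInstr → RamState → RamState
  | [], σ => σ
  | i :: l, σ => evalL l (i.eval σ)

/-- All numbers read by an instruction, which is not a multiplication, are less than `B`. -/
def ReadsLt (B : ℕ) : RamInstr → RamState → Prop
  | .const _ c, _ => c < B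
  | .move _ y, σ => σ.reg y < B
  | .add _ y z, σ => σ.reg y < B ∧ σ.reg z < B
  | .sub _ y z, σ => σ.reg y < B ∧ σ.reg z < B
  | .mul _ _ _, _ => False
  -- A left shift is charged its shift amount, not the bit length of that amount, hence the power of
  -- two.
  | .shiftL _ y z, σ => σ.reg y < B ∧ 2 ^ σ.reg z ≤ B
  | .shiftR _ y z, σ => σ.reg y < B ∧ σ.reg z < B
  | .len _ y, σ => σ.reg y < B
  | .load _ a y, σ => σ.reg y < B ∧ σ.arr a (σ.reg y) < B
  | .store _ x y, σ => σ.reg x < B ∧ σ.reg y < B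

lemma cost_le_of_readsLt {S : ℕ} {i : RamInstr} {σ : RamState} (h : ReadsLt (2 ^ S) i σ) :
    i.cost mc σ ≤ 1 + 2 * S := by
  cases i with
  | const x c => have := size_le_of_lt h; simp only [RamInstr.cost]; omega
  | move x y => have := size_le_of_lt h; simp only [RamInstr.cost]; omega
  | len x y => have := size_le_of_lt h; simp only [RamInstr.cost]; omega
  | mul => exact h.elim
  | shiftL x y z =>
    have := size_le_of_lt h.1
    have := (Nat.pow_le_pow_iff_right (by norm_num)).1 h.2
    simp only [RamInstr.cost]; omega
  | _ =>
    have := size_le_of_lt h.1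
    have := size_le_of_lt h.2
    simp only [RamInstr.cost]; omega

/-- All numbers read by a sequence of instructions are less than `B`. -/
def AllReadsLt (B : ℕ) : List RamInstr → RamState → Prop
  | [], _ => True
  | i :: l, σ => ReadsLt B i σ ∧ AllReadsLt B l (i.eval σ)

lemma Runs.block {S : ℕ} {l : List RamInstr} {σ : RamState} (h : AllReadsLt (2 ^ S) l σ) :
    Runs mc (block l) σ (l.length * (1 + 2 * S)) (evalL l σ) := by
  induction l generalizing σ with
  | nil => exact ⟨0, Nat.zero_le _, .skip σ⟩
  | cons i l ih =>
    have h1 : Runs mc (.instr i) σ (1 + 2 * S) (i.eval σ) :=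
      ⟨_, cost_le_of_readsLt h.1, .instr i σ⟩
    exact (h1.seq (ih h.2)).mono (by rw [List.length_cons]; apply le_of_eq; ring)

end Runs

/-! ### Floating-point addition on the machine. -/

/-- The floating-point number `i` in the array number `k`: mantissas are stored in the
array `2 * k` of the machine and exponents in the array `2 * k + 1`. -/
def fl (σ : RamState) (k i : ℕ) : ℕ × ℕ := (σ.arr (2 * k) i, σ.arr (2 * k + 1) i)

/-- All registers except for the scratch registers `10` to `15` agree. -/
def Keep (σ τ : RamState) : Prop := ∀ j, (j < 10 ∨ 16 ≤ j) → τ.reg j = σ.reg j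

lemma Keep.trans {σ τ υ : RamState} (h : Keep σ τ) (h' : Keep τ υ) : Keep σ υ :=
  fun j hj => (h' j hj).trans (h j hj)

/-- `τ` results from `σ` by writing `x` into entry `i` of the array `k` of floating-point
numbers, up to scratch registers. -/
structure Writes (σ τ : RamState) (k i : ℕ) (x : ℕ × ℕ) : Prop where
  keep : Keep σ τ
  fl_eq : ∀ k' i', fl τ k' i' = if k' = k ∧ i' = i then x else fl σ k' i'

/-- Normalise the floating-point number in the registers `10` and `11`. -/
def normP : List RamInstr :=
  [.len 14 10, .sub 14 14 2, .shiftR 10 10 14, .add 11 11 14]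

/-- Store the floating-point number in the registers `10` and `11`. -/
def storeP (k : ℕ) : List RamInstr :=
  [.store (2 * k) 6 10, .store (2 * k + 1) 6 11]

/-- Add the floating-point number in the registers `12` and `13` to the one in `10` and `11`. -/
def addP : List RamInstr :=
  [.sub 14 13 11, .sub 15 11 13, .shiftR 10 10 14, .shiftR 12 12 15, .add 10 10 12, .add 11 11 14]

/-- Load a floating-point number from array `k` and one from array `k'`. -/
def loadP (k k' : ℕ) : List RamInstr :=
  [.load 10 (2 * k) 6, .load 11 (2 * k + 1) 6, .load 12 (2 * k') 8, .load 13 (2 * k' + 1) 8]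

lemma lt_two_pow_of_size_le {a S : ℕ} (h : Nat.size a ≤ S) : a < 2 ^ S := Nat.size_le.1 h

lemma runs_normP {mc : ℕ → ℕ} {S : ℕ} {σ : RamState} (h10 : σ.reg 10 < 2 ^ S)
    (h11 : σ.reg 11 < 2 ^ S) (h2 : σ.reg 2 < 2 ^ S) :
    ∃ τ, Runs mc (block normP) σ (4 * (1 + 2 * S)) τ ∧ Keep σ τ ∧ τ.arr = σ.arr ∧
      (τ.reg 10, τ.reg 11) = normF (σ.reg 2) (σ.reg 10, σ.reg 11) := by
  refine ⟨_, Runs.block (l := normP) ?_, ?_, ?_, ?_⟩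
  · have h1 := size_le_of_lt h10
    have h3 := (Nat.lt_two_pow_self (n := S))
    simp only [normP, AllReadsLt, ReadsLt, RamInstr.eval, RamState.setReg, Function.update]
    simp
    omega
  · intro j hj
    have : j ≠ 10 := by omega
    have : j ≠ 11 := by omega
    have : j ≠ 14 := by omega
    simp [normP, evalL, RamInstr.eval, RamState.setReg, Function.update, *]
  · simp [normP, evalL, RamInstr.eval, RamState.setReg]
  · simp [normP, evalL, RamInstr.eval, RamState.setReg, Function.update, normF]

lemma runs_storeP {mc : ℕ → ℕ} {S k : ℕ} {σ : RamState} (h10 : σ.reg 10 < 2 ^ S)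
    (h11 : σ.reg 11 < 2 ^ S) (h6 : σ.reg 6 < 2 ^ S) :
    ∃ τ, Runs mc (block (storeP k)) σ (2 * (1 + 2 * S)) τ ∧
      Writes σ τ k (σ.reg 6) (σ.reg 10, σ.reg 11) := by
  refine ⟨_, Runs.block (l := storeP k) ?_, ?_, ?_⟩
  · simp [storeP, AllReadsLt, ReadsLt, RamInstr.eval, RamState.setArr, *]
  · intro j hj
    simp [storeP, evalL, RamInstr.eval, RamState.setArr]
  · intro k' i'
    have h1 : 2 * k ≠ 2 * k' + 1 := by omega
    have h2 : 2 * k' ≠ 2 * k + 1 := by omega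
    by_cases hk : k' = k <;> by_cases hi : i' = σ.reg 6 <;>
    simp [storeP, evalL, RamInstr.eval, RamState.setArr, fl, Function.update, *, h1.symm]

lemma runs_loadP {mc : ℕ → ℕ} {S k k' : ℕ} {σ : RamState} (h6 : σ.reg 6 < 2 ^ S)
    (h8 : σ.reg 8 < 2 ^ S) (hx1 : (fl σ k (σ.reg 6)).1 < 2 ^ S) (hx2 : (fl σ k (σ.reg 6)).2 < 2 ^ S)
    (hy1 : (fl σ k' (σ.reg 8)).1 < 2 ^ S) (hy2 : (fl σ k' (σ.reg 8)).2 < 2 ^ S) :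
    ∃ τ, Runs mc (block (loadP k k')) σ (4 * (1 + 2 * S)) τ ∧ Keep σ τ ∧ τ.arr = σ.arr ∧
      (τ.reg 10, τ.reg 11) = fl σ k (σ.reg 6) ∧ (τ.reg 12, τ.reg 13) = fl σ k' (σ.reg 8) := by
  refine ⟨_, Runs.block (l := loadP k k') ?_, ?_, ?_, ?_, ?_⟩
  · simp only [fl] at *
    simp [loadP, AllReadsLt, ReadsLt, RamInstr.eval, RamState.setReg, *]
  · intro j hj
    have : j ≠ 10 := by omega
    have : j ≠ 11 := by omega
    have : j ≠ 12 := by omega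
    have : j ≠ 13 := by omega
    simp [loadP, evalL, RamInstr.eval, RamState.setReg, Function.update, *]
  · simp [loadP, evalL, RamInstr.eval, RamState.setReg]
  · simp [loadP, evalL, RamInstr.eval, RamState.setReg, Function.update, fl]
  · simp [loadP, evalL, RamInstr.eval, RamState.setReg, Function.update, fl]

lemma runs_addP {mc : ℕ → ℕ} {S : ℕ} {σ : RamState} (h10 : σ.reg 10 < 2 ^ S)
    (h11 : σ.reg 11 < 2 ^ S) (h12 : σ.reg 12 < 2 ^ S) (h13 : σ.reg 13 < 2 ^ S) :
    ∃ τ, Runs mc (block addP) σ (6 * (1 + 2 * S)) τ ∧ Keep σ τ ∧ τ.arr = σ.arr ∧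
      τ.reg 10 = σ.reg 10 / 2 ^ (σ.reg 13 - σ.reg 11) + σ.reg 12 / 2 ^ (σ.reg 11 - σ.reg 13) ∧
      τ.reg 11 = σ.reg 11 + (σ.reg 13 - σ.reg 11) := by
  refine ⟨_, Runs.block (l := addP) ?_, ?_, ?_, ?_, ?_⟩
  · have h1 := Nat.div_le_self (σ.reg 10) (2 ^ (σ.reg 13 - σ.reg 11))
    have h3 := Nat.div_le_self (σ.reg 12) (2 ^ (σ.reg 11 - σ.reg 13))
    simp only [addP, AllReadsLt, ReadsLt, RamInstr.eval, RamState.setReg, Function.update]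
    simp
    omega
  · intro j hj
    have : j ≠ 10 := by omega
    have : j ≠ 11 := by omega
    have : j ≠ 12 := by omega
    have : j ≠ 14 := by omega
    have : j ≠ 15 := by omega
    simp [addP, evalL, RamInstr.eval, RamState.setReg, Function.update, *]
  · simp [addP, evalL, RamInstr.eval, RamState.setReg]
  · simp [addP, evalL, RamInstr.eval, RamState.setReg, Function.update]
  · simp [addP, evalL, RamInstr.eval, RamState.setReg, Function.update]

/-- Add entry `reg 8` of the array `k'` to entry `reg 6` of the array `k`. -/
def accP (k k' : ℕ) : RamProg :=
  .seq (block (loadP k k')) (.seq (block addP) (.seq (block normP) (block (storeP k))))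

lemma runs_accP {mc : ℕ → ℕ} {L k k' : ℕ} {σ : RamState} (hL : 2 ≤ L) (h2 : σ.reg 2 = L)
    (h6 : σ.reg 6 < 2 ^ L) (h8 : σ.reg 8 < 2 ^ L) (hx1 : (fl σ k (σ.reg 6)).1 < 2 ^ L)
    (hx2 : (fl σ k (σ.reg 6)).2 < 2 ^ L) (hy1 : (fl σ k' (σ.reg 8)).1 < 2 ^ L)
    (hy2 : (fl σ k' (σ.reg 8)).2 < 2 ^ L) :
    ∃ τ, Runs mc (accP k k') σ (100 * L) τ ∧
      Writes σ τ k (σ.reg 6) (addF L (fl σ k (σ.reg 6)) (fl σ k' (σ.reg 8))) := by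
  obtain ⟨σ1, r1, k1, a1, e1, e1'⟩ := runs_loadP (mc := mc) h6 h8 hx1 hx2 hy1 hy2
  set x := fl σ k (σ.reg 6)
  set y := fl σ k' (σ.reg 8)
  obtain ⟨i1, i2⟩ : σ1.reg 10 = x.1 ∧ σ1.reg 11 = x.2 := by rw [← e1]; exact ⟨rfl, rfl⟩
  obtain ⟨i3, i4⟩ : σ1.reg 12 = y.1 ∧ σ1.reg 13 = y.2 := by rw [← e1']; exact ⟨rfl, rfl⟩
  rw [← i1] at hx1
  rw [← i2] at hx2
  rw [← i3] at hy1
  rw [← i4] at hy2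
  obtain ⟨σ2, r2, k2, a2, j1, j2⟩ := runs_addP (mc := mc) hx1 hx2 hy1 hy2
  have hL2 : L < 2 ^ L := Nat.lt_two_pow_self
  have hp : 2 ^ (L + 1) = 2 * 2 ^ L := by rw [pow_succ, mul_comm]
  have hd1 := Nat.div_le_self (σ1.reg 10) (2 ^ (σ1.reg 13 - σ1.reg 11))
  have hd2 := Nat.div_le_self (σ1.reg 12) (2 ^ (σ1.reg 11 - σ1.reg 13))
  have h22 : σ2.reg 2 = L := by rw [k2 2 (by omega), k1 2 (by omega), h2]
  -- The sum of two `L`-bit mantissas may need `L + 1` bits before normalisation.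
  obtain ⟨σ3, r3, k3, a3, e3⟩ := runs_normP (mc := mc) (S := L + 1) (σ := σ2) (by omega)
    (by omega) (by omega)
  have hadd : (σ3.reg 10, σ3.reg 11) = addF L x y := by
    rw [e3, addF, h22, j1, j2, i1, i2, i3, i4]
  have h36 : σ3.reg 6 = σ.reg 6 := by
    rw [k3 6 (by omega), k2 6 (by omega), k1 6 (by omega)]
  have hn1 : σ3.reg 10 ≤ σ2.reg 10 := by
    rw [show σ3.reg 10 = (normF (σ2.reg 2) (σ2.reg 10, σ2.reg 11)).1 by rw [← e3]]
    exact Nat.div_le_self _ _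
  have hn2 : σ3.reg 11 ≤ σ2.reg 11 + 1 := by
    rw [show σ3.reg 11 = (normF (σ2.reg 2) (σ2.reg 10, σ2.reg 11)).2 by rw [← e3]]
    have := size_le_of_lt (a := σ2.reg 10) (S := L + 1) (by omega)
    simp only [normF]
    omega
  obtain ⟨σ4, r4, w4⟩ := runs_storeP (mc := mc) (k := k) (S := L + 1) (σ := σ3) (by omega)
    (by omega) (by omega)
  refine ⟨σ4, (r1.seq (r2.seq (r3.seq r4))).mono (by omega),
    ((k1.trans k2).trans k3).trans w4.keep, ?_⟩
  intro k'' i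
  rw [w4.fl_eq, hadd, h36]
  simp only [fl, a3, a2, a1]


lemma Runs.iteTrue {mc : ℕ → ℕ} {x y S N : ℕ} {p q : RamProg} {σ τ : RamState}
    (hx : σ.reg x < 2 ^ S) (hy : σ.reg y < 2 ^ S) (h : σ.reg x < σ.reg y) (hp : Runs mc p σ N τ) :
    Runs mc (.ite x y p q) σ (1 + 2 * S + N) τ :=
  let ⟨_, hc, h'⟩ := hp
  ⟨_, add_le_add (testCost_le hx hy) hc, .iteTrue h h'⟩

lemma Runs.iteFalse {mc : ℕ → ℕ} {x y S N : ℕ} {p q : RamProg} {σ τ : RamState}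
    (hx : σ.reg x < 2 ^ S) (hy : σ.reg y < 2 ^ S) (h : ¬ σ.reg x < σ.reg y)
    (hq : Runs mc q σ N τ) : Runs mc (.ite x y p q) σ (1 + 2 * S + N) τ :=
  let ⟨_, hc, h'⟩ := hq
  ⟨_, add_le_add (testCost_le hx hy) hc, .iteFalse h h'⟩

/-! ### Multiplication by `2 ^ s - g` without a multiplication instruction. -/

/-- Add the product of the registers `16` and `g` to register `12`, by repeated addition. -/
def mulP (g : ℕ) : RamProg := .loop 13 g (block [.add 12 12 16, .add 13 13 3])

lemma runs_mulP {mc : ℕ → ℕ} {S g : ℕ} {σ : RamState} (hg : g < 10 ∨ 16 ≤ g) (hg16 : g ≠ 16)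
    (h12 : σ.reg 12 = 0) (h13 : σ.reg 13 = 0) (h3 : σ.reg 3 = 1) (hS : 1 ≤ S)
    (h16 : σ.reg 16 < 2 ^ S) (hgS : σ.reg g < 2 ^ S) (hmul : σ.reg g * σ.reg 16 < 2 ^ S) :
    ∃ τ, Runs mc (mulP g) σ (σ.reg g * (1 + 2 * S + 2 * (1 + 2 * S)) + (1 + 2 * S)) τ ∧
      τ.arr = σ.arr ∧ (∀ j, j ≠ 12 → j ≠ 13 → τ.reg j = σ.reg j) ∧
      τ.reg 12 = σ.reg g * σ.reg 16 := by
  let Inv : ℕ → RamState → Prop := fun k τ => τ.arr = σ.arr ∧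
    (∀ j, j ≠ 12 → j ≠ 13 → τ.reg j = σ.reg j) ∧ τ.reg 12 = k * σ.reg 16 ∧ τ.reg 13 = k
  have h1S : 1 < 2 ^ S := Nat.one_lt_two_pow (by omega)
  have hk : ∀ k ≤ σ.reg g, k * σ.reg 16 < 2 ^ S := fun k hk =>
    (Nat.mul_le_mul_right _ hk).trans_lt hmul
  obtain ⟨τ, hr, h1, h2, h3, -⟩ := Runs.loop (mc := mc) (x := 13) (y := g)
    (p := block [.add 12 12 16, .add 13 13 3]) Inv (S := S) (T := 2 * (1 + 2 * S)) (N := σ.reg g)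
    (fun k hkN τ hτ => by
      obtain ⟨h1, h2, h3, h4⟩ := hτ
      have := h2 g (by omega) (by omega)
      omega)
    (fun k hkN τ hτ => by
      obtain ⟨h1, h2, h5, h4⟩ := hτ
      have e1 := h2 g (by omega) (by omega)
      have e2 := h2 16 (by omega) (by omega)
      have e3 := h2 3 (by omega) (by omega)
      refine ⟨by omega, _, Runs.block ?_, ?_, ?_, ?_, ?_⟩
      · have := hk k hkN.le
        simp [AllReadsLt, ReadsLt, RamInstr.eval, RamState.setReg, Function.update]
        omega
      · simpa [evalL, RamInstr.eval, RamState.setReg] using h1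
      · intro j hj hj'
        simp [evalL, RamInstr.eval, RamState.setReg, hj, hj', h2]
      · simp [evalL, RamInstr.eval, RamState.setReg, h5, e2]
        ring
      · simp [evalL, RamInstr.eval, RamState.setReg, h4, e3, h3])
    (fun τ hτ => by
      obtain ⟨h1, h2, h3, h4⟩ := hτ
      have := h2 g (by omega) (by omega)
      omega) σ ⟨rfl, fun _ _ _ => rfl, by simpa using h12, h13⟩
  exact ⟨τ, hr, h1, h2, h3⟩

/-- Store the product of the floating-point number in the registers `16` and `17` by
`2 ^ reg 18 - reg g` in entry `reg 6` of the array `k`. -/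
def scaleP (g k : ℕ) : RamProg :=
  .seq (block [.shiftL 10 16 18, .const 12 0, .const 13 0]) (.seq (mulP g)
    (.seq (block [.sub 10 10 12, .move 11 17]) (.seq (block normP)
      (.seq (.ite 4 10 .skip (block [.const 11 0])) (block (storeP k))))))

lemma runs_scaleP {mc : ℕ → ℕ} {n L g k : ℕ} {σ : RamState} (hn : 1 ≤ n) (hL : 2 ≤ L)
    (hnL : n < 2 ^ L) (hg : g < 10 ∨ 18 ≤ g) (h2 : σ.reg 2 = L) (h3 : σ.reg 3 = 1)
    (h4 : σ.reg 4 = 0)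
    (h6 : σ.reg 6 < 2 ^ L) (h16 : σ.reg 16 < 2 ^ L) (h17 : σ.reg 17 < 2 ^ L)
    (h18 : σ.reg 18 ≤ n) (hgn : σ.reg g ≤ n) :
    ∃ τ, Runs mc (scaleP g k) σ (200 * (n * L)) τ ∧
      Writes σ τ k (σ.reg 6) (scaleF L (σ.reg 18) (σ.reg g) (σ.reg 16, σ.reg 17)) := by
  -- Room for the mantissa shifted by at most `n`, for the product with `g ≤ n < 2 ^ L`, and for the
  -- new exponent.
  set S := 2 * L + n with hS
  have p1 : 2 ^ L ≤ 2 ^ S := Nat.pow_le_pow_right (by norm_num) (by omega)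
  have p2 : 2 ^ n ≤ 2 ^ S := Nat.pow_le_pow_right (by norm_num) (by omega)
  have p3 : 2 ^ (2 * L) ≤ 2 ^ S := Nat.pow_le_pow_right (by norm_num) (by omega)
  have p4 : 2 ^ L ≤ 2 ^ (2 * L) := Nat.pow_le_pow_right (by norm_num) (by omega)
  have p5 : 2 ^ σ.reg 18 ≤ 2 ^ n := Nat.pow_le_pow_right (by norm_num) h18
  have p6 : S < 2 ^ S := Nat.lt_two_pow_self
  have hmul : σ.reg g * σ.reg 16 < 2 ^ (2 * L) := by
    rw [two_mul, pow_add]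
    exact Nat.mul_lt_mul'' (by omega) h16
  have hsh : σ.reg 16 * 2 ^ σ.reg 18 < 2 ^ S := by
    calc σ.reg 16 * 2 ^ σ.reg 18 < 2 ^ L * 2 ^ n := Nat.mul_lt_mul_of_lt_of_le h16 p5 (by positivity)
      _ = 2 ^ (L + n) := (pow_add _ _ _).symm
      _ ≤ 2 ^ S := Nat.pow_le_pow_right (by norm_num) (by omega)
  have r1 : Runs mc _ σ (3 * (1 + 2 * S)) _ := Runs.block
    (l := [.shiftL 10 16 18, .const 12 0, .const 13 0]) (S := S) (σ := σ) (by
      simp only [AllReadsLt, ReadsLt, and_true]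
      refine ⟨⟨?_, ?_⟩, ?_, ?_⟩ <;> omega)
  set σ1 := evalL [.shiftL 10 16 18, .const 12 0, .const 13 0] σ with hσ1
  have k1 : Keep σ σ1 := by
    intro j hj
    have : j ≠ 10 := by omega
    have : j ≠ 12 := by omega
    have : j ≠ 13 := by omega
    simp [σ1, evalL, RamInstr.eval, RamState.setReg, Function.update, *]
  have a1 : σ1.arr = σ.arr := by simp [hσ1, evalL, RamInstr.eval, RamState.setReg]
  have e10 : σ1.reg 10 = σ.reg 16 * 2 ^ σ.reg 18 := by
    simp [hσ1, evalL, RamInstr.eval, RamState.setReg, Function.update]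
  have e16 := k1 16 (by omega)
  have eg := k1 g (by omega)
  obtain ⟨σ2, r2, a2, k2, e12⟩ := runs_mulP (mc := mc) (S := 2 * L) (g := g) (σ := σ1)
    (by omega) (by omega) (by simp [hσ1, evalL, RamInstr.eval, RamState.setReg, Function.update])
    (by simp [hσ1, evalL, RamInstr.eval, RamState.setReg, Function.update])
    (by rw [k1 3 (by omega), h3]) (by omega) (by omega) (by omega) (by rw [eg, e16]; exact hmul)
  have f10 := k2 10 (by omega) (by omega)
  have f17 : σ2.reg 17 = σ.reg 17 := by rw [k2 17 (by omega) (by omega), k1 17 (by omega)]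
  rw [eg, e16] at e12
  have r3 : Runs mc _ σ2 (2 * (1 + 2 * S)) _ := Runs.block
    (l := [.sub 10 10 12, .move 11 17]) (S := S) (σ := σ2) (by
      simp [AllReadsLt, ReadsLt, RamInstr.eval, RamState.setReg, Function.update]
      omega)
  set σ3 := evalL [.sub 10 10 12, .move 11 17] σ2 with hσ3
  have k3 : Keep σ2 σ3 := by
    intro j hj
    have : j ≠ 10 := by omega
    have : j ≠ 11 := by omega
    simp [σ3, evalL, RamInstr.eval, RamState.setReg, Function.update, *]
  have k13 : Keep σ σ3 := fun j hj => by
    rw [k3 j hj, k2 j (by omega) (by omega), k1 j hj]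
  have a3 : σ3.arr = σ.arr := by
    rw [← a1, ← a2]
    simp [hσ3, evalL, RamInstr.eval, RamState.setReg]
  have g10 : σ3.reg 10 = σ.reg 16 * 2 ^ σ.reg 18 - σ.reg g * σ.reg 16 := by
    rw [← e10, ← f10, ← e12]
    simp [hσ3, evalL, RamInstr.eval, RamState.setReg, Function.update]
  have g11 : σ3.reg 11 = σ.reg 17 := by
    rw [← f17]
    simp [hσ3, evalL, RamInstr.eval, RamState.setReg, Function.update]
  have g2 := k13 2 (by omega)
  obtain ⟨σ4, r4, k4, a4, e4⟩ := runs_normP (mc := mc) (S := S) (σ := σ3) (by omega) (by omega)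
    (by omega)
  rw [g2, h2, g10, g11] at e4
  set z := normF L (σ.reg 16 * 2 ^ σ.reg 18 - σ.reg g * σ.reg 16, σ.reg 17) with hz
  have hz10 : σ4.reg 10 = z.1 := congrArg Prod.fst e4
  have hz11 : σ4.reg 11 = z.2 := congrArg Prod.snd e4
  have hzS : z.1 < 2 ^ S := by
    have := Nat.div_le_self (σ.reg 16 * 2 ^ σ.reg 18 - σ.reg g * σ.reg 16)
      (2 ^ (Nat.size (σ.reg 16 * 2 ^ σ.reg 18 - σ.reg g * σ.reg 16) - L))
    simp only [hz, normF]
    omega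
  have hzS2 : z.2 < 2 ^ S := by
    have := size_le_of_lt (a := σ.reg 16 * 2 ^ σ.reg 18 - σ.reg g * σ.reg 16) (S := S) (by omega)
    have p7 : L < 2 ^ L := Nat.lt_two_pow_self
    have p8 : 2 ^ L + 2 ^ L + n ≤ 2 ^ S := by
      have : n < 2 ^ n := Nat.lt_two_pow_self
      have h9 : 2 ^ S = 2 ^ L * 2 ^ L * 2 ^ n := by rw [hS, two_mul, pow_add, pow_add]
      have h10 : 2 ≤ 2 ^ n := by
        calc 2 = 2 ^ 1 := rfl
          _ ≤ 2 ^ n := Nat.pow_le_pow_right (by norm_num) hn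
      have h11 : 4 ≤ 2 ^ L := by
        calc 4 = 2 ^ 2 := rfl
          _ ≤ 2 ^ L := Nat.pow_le_pow_right (by norm_num) hL
      rw [h9]
      have h12 : 4 * 2 ^ L * 2 ^ n ≤ 2 ^ L * 2 ^ L * 2 ^ n :=
        Nat.mul_le_mul_right _ (Nat.mul_le_mul_right _ h11)
      have h13 : 2 ^ L * 2 ≤ 2 ^ L * 2 ^ n := Nat.mul_le_mul_left _ h10
      have h14 : 4 * 2 ^ n ≤ 2 ^ L * 2 ^ n := Nat.mul_le_mul_right _ h11
      linarith
    simp only [hz, normF]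
    omega
  have k14 := k13.trans k4
  have g4 := k14 4 (by omega)
  obtain ⟨σ5, r5, k5, a5, e5⟩ : ∃ σ5, Runs mc (.ite 4 10 .skip (block [.const 11 0])) σ4
      (1 + 2 * S + (1 + 2 * S)) σ5 ∧ Keep σ4 σ5 ∧ σ5.arr = σ4.arr ∧
      (σ5.reg 10, σ5.reg 11) = scaleF L (σ.reg 18) (σ.reg g) (σ.reg 16, σ.reg 17) := by
    by_cases h : σ4.reg 4 < σ4.reg 10
    · refine ⟨σ4, Runs.iteTrue (by omega) (by omega) h ⟨0, Nat.zero_le _, .skip _⟩,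
        fun _ _ => rfl, rfl, ?_⟩
      rw [scaleF, if_pos (by dsimp only; rw [← hz]; omega), hz10, hz11]
    · refine ⟨_, Runs.iteFalse (by omega) (by omega) h
        ((Runs.block (l := [.const 11 0]) (S := S) ?_).mono (by simp)), ?_, ?_, ?_⟩
      · simp [AllReadsLt, ReadsLt]
      · intro j hj
        have : j ≠ 11 := by omega
        simp [evalL, RamInstr.eval, RamState.setReg, Function.update, *]
      · simp [evalL, RamInstr.eval, RamState.setReg]
      · rw [scaleF, if_neg (by dsimp only; rw [← hz]; omega)]
        simp [evalL, RamInstr.eval, RamState.setReg, Function.update, hz10, hz]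
  have k15 := k14.trans k5
  have hs1 : σ5.reg 10 ≤ z.1 := by
    rw [show σ5.reg 10 = (scaleF L (σ.reg 18) (σ.reg g) (σ.reg 16, σ.reg 17)).1 by rw [← e5],
      scaleF]
    split_ifs <;> rfl
  have hs2 : σ5.reg 11 ≤ z.2 := by
    rw [show σ5.reg 11 = (scaleF L (σ.reg 18) (σ.reg g) (σ.reg 16, σ.reg 17)).2 by rw [← e5],
      scaleF]
    split_ifs
    · rfl
    · exact Nat.zero_le _
  have i6 := k15 6 (by omega)
  obtain ⟨σ6, r6, w6⟩ := runs_storeP (mc := mc) (k := k) (S := S) (σ := σ5) (by omega)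
    (by omega) (by omega)
  refine ⟨σ6, (r1.seq (r2.seq (r3.seq (r4.seq (r5.seq r6))))).mono ?_, k15.trans w6.keep, ?_⟩
  -- The repeated addition handles only numbers below `2 ^ (2 * L)`; bounding it with `S` instead
  -- would give a term of order `n ^ 2`.
  · have t1 : σ1.reg g * (1 + 2 * (2 * L) + 2 * (1 + 2 * (2 * L))) ≤
        n * (1 + 2 * (2 * L) + 2 * (1 + 2 * (2 * L))) := Nat.mul_le_mul_right _ (by omega)
    have t2 : n * (1 + 2 * (2 * L) + 2 * (1 + 2 * (2 * L))) = 3 * n + 12 * (n * L) := by ring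
    have t3 : n * 2 ≤ n * L := Nat.mul_le_mul_left _ hL
    have t4 : 1 * L ≤ n * L := Nat.mul_le_mul_right _ hn
    omega
  · intro k' i'
    rw [w6.fl_eq, e5, i6]
    simp only [fl, a5, a4, a3]


/-! ### Initialising the three weighted sequences. -/

/-- The binary exponent of the weight of an entry, where `none` stands for the weights `1`. -/
def expOf : Option Family → ℕ → ℕ
  | none, _ => 0
  | some _, p => p

/-- The correction in the weight of an entry. -/
def corrOf : Option Family → ℕ → ℕ → ℕ → ℕ
  | none, _, _, _ => 0
  | some t, m, p, i => corr t m p i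

/-- Compute the weights of the entry `reg 6`. -/
def weightP : Option Family → List RamInstr
  | none => [.const 18 0, .const 20 0, .const 21 0]
  | some .all => [.move 18 6, .const 20 0, .const 21 0]
  | some .essential => [.move 18 6, .move 20 6, .const 21 1]
  | some .extensional => [.move 18 6, .move 20 5, .const 21 0]

/-- Decrement `reg 6` and load the entry `reg 6` and its weights. -/
def loadWeightsP (o : Option Family) : List RamInstr :=
  .sub 6 6 3 :: weightP o ++ [.load 16 0 6, .load 17 1 6]

/-- Initialise the entry preceding `reg 6` in the three arrays. -/
def initStepP (o : Option Family) : RamProg :=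
  .seq (block (loadWeightsP o))
    (.seq (scaleP 20 0) (.seq (scaleP 21 1) (scaleP 4 2)))

lemma corrOf_of_two_le (o : Option Family) (m p i : ℕ) (hi : 2 ≤ i) : corrOf o m p i = 0 := by
  cases o with
  | none => rfl
  | some t => simp only [corrOf, corr]; rw [if_neg (by omega), if_neg (by omega)]

lemma corrOf_le {o : Option Family} {n m p i : ℕ} (hn : 1 ≤ n) (hm : m ≤ n) (hp : p ≤ m) :
    corrOf o m p i ≤ n := by
  cases o with
  | none => exact Nat.zero_le _
  | some t =>
    simp only [corrOf, corr]
    cases t <;> simp only [gam, bet] <;> split_ifs <;> omega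

lemma expOf_le (o : Option Family) (p : ℕ) : expOf o p ≤ p := by
  cases o with
  | none => exact Nat.zero_le _
  | some t => exact le_rfl

lemma runs_weights {mc : ℕ → ℕ} {L p m : ℕ} {o : Option Family} {σ : RamState} (hL : 1 ≤ L)
    (h3 : σ.reg 3 = 1) (h5 : σ.reg 5 = m) (hm : m < 2 ^ L) (h6 : σ.reg 6 = p + 1)
    (hp : p + 1 < 2 ^ L) (hx1 : (fl σ 0 p).1 < 2 ^ L) (hx2 : (fl σ 0 p).2 < 2 ^ L) :
    ∃ τ, Runs mc (block (loadWeightsP o)) σ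
      (6 * (1 + 2 * L)) τ ∧ τ.arr = σ.arr ∧ (∀ j ≤ 5, τ.reg j = σ.reg j) ∧ τ.reg 6 = p ∧
      (τ.reg 16, τ.reg 17) = fl σ 0 p ∧ τ.reg 18 = expOf o p ∧ τ.reg 20 = corrOf o m p 0 ∧
      τ.reg 21 = corrOf o m p 1 := by
  have h1L : 1 < 2 ^ L := Nat.one_lt_two_pow (by omega)
  have hp' : p < 2 ^ L := by omega
  have h0 : 0 < 2 ^ L := by omega
  simp only [fl, mul_zero, zero_add] at hx1 hx2
  have hlen : (loadWeightsP o).length = 6 := by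
    rcases o with _ | (_ | _ | _) <;> rfl
  rw [← hlen]
  refine ⟨_, Runs.block (l := loadWeightsP o) ?_,
    ?_, ?_, ?_, ?_, ?_, ?_, ?_⟩
  · rcases o with _ | (_ | _ | _) <;>
    simp [loadWeightsP, weightP, AllReadsLt, ReadsLt, RamInstr.eval, RamState.setReg, Function.update, *]
  · rcases o with _ | (_ | _ | _) <;>
    simp [loadWeightsP, weightP, evalL, RamInstr.eval, RamState.setReg]
  · intro j hj
    have : j ≠ 6 := by omega
    have : j ≠ 16 := by omega
    have : j ≠ 17 := by omega
    have : j ≠ 18 := by omega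
    have : j ≠ 20 := by omega
    have : j ≠ 21 := by omega
    rcases o with _ | (_ | _ | _) <;>
    simp [loadWeightsP, weightP, evalL, RamInstr.eval, RamState.setReg, Function.update, *]
  all_goals
    rcases o with _ | (_ | _ | _) <;>
    simp [loadWeightsP, weightP, evalL, RamInstr.eval, RamState.setReg, Function.update, fl, expOf, corrOf,
      corr, gam, bet, *]

/-- The source entry is held in registers `16` and `17`, outside the scratch range, so it survives
the overwriting of array `0`. Register `4` holds `0`, the correction for all `i ≥ 2`. -/
lemma runs_initStepP {mc : ℕ → ℕ} {n L p m : ℕ} {o : Option Family} {σ : RamState} (hn : 1 ≤ n)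
    (hL : 2 ≤ L) (hnL : n + 1 < 2 ^ L) (h2 : σ.reg 2 = L) (h3 : σ.reg 3 = 1) (h4 : σ.reg 4 = 0)
    (h5 : σ.reg 5 = m) (hm : m ≤ n) (h6 : σ.reg 6 = p + 1)
    (hp : p ≤ m) (hx1 : (fl σ 0 p).1 < 2 ^ L) (hx2 : (fl σ 0 p).2 < 2 ^ L) :
    ∃ τ, Runs mc (initStepP o) σ (700 * (n * L)) τ ∧ (∀ j ≤ 5, τ.reg j = σ.reg j) ∧ τ.reg 6 = p ∧
      ∀ k i, fl τ k i = if i = p ∧ k < 3 then scaleF L (expOf o p) (corrOf o m p k) (fl σ 0 p)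
        else fl σ k i := by
  obtain ⟨σ1, r1, a1, k1, e6, ex, e18, e20, e21⟩ := runs_weights (mc := mc) (o := o) (by omega) h3
    h5 (by omega) h6 (by omega) hx1 hx2
  have hfl : ∀ k i, fl σ1 k i = fl σ k i := fun k i => by simp only [fl, a1]
  have hs := expOf_le o p
  have hc := fun i => corrOf_le (o := o) (i := i) hn hm hp
  have ex1 : σ1.reg 16 = (fl σ 0 p).1 := congrArg Prod.fst ex
  have ex2 : σ1.reg 17 = (fl σ 0 p).2 := congrArg Prod.snd ex
  have k12 := k1 2 (by omega)
  have k13 := k1 3 (by omega)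
  have k14 := k1 4 (by omega)
  obtain ⟨σ2, r2, w2⟩ := runs_scaleP (mc := mc) (k := 0) (g := 20) (σ := σ1) hn hL (by omega)
    (by omega) (by omega) (by omega) (by omega) (by omega) (by omega) (by omega) (by omega)
    (by rw [e20]; exact hc 0)
  have k2 := w2.keep
  have k22 := k2 2 (by omega)
  have k23 := k2 3 (by omega)
  have k24 := k2 4 (by omega)
  have k26 := k2 6 (by omega)
  have k216 := k2 16 (by omega)
  have k217 := k2 17 (by omega)
  have k218 := k2 18 (by omega)
  have k221 := k2 21 (by omega)
  obtain ⟨σ3, r3, w3⟩ := runs_scaleP (mc := mc) (k := 1) (g := 21) (σ := σ2) hn hL (by omega)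
    (by omega) (by omega) (by omega) (by omega) (by omega) (by omega) (by omega) (by omega)
    (by rw [k221, e21]; exact hc 1)
  have k3 := w3.keep
  have k32 := k3 2 (by omega)
  have k33 := k3 3 (by omega)
  have k34 := k3 4 (by omega)
  have k36 := k3 6 (by omega)
  have k316 := k3 16 (by omega)
  have k317 := k3 17 (by omega)
  have k318 := k3 18 (by omega)
  obtain ⟨σ4, r4, w4⟩ := runs_scaleP (mc := mc) (k := 2) (g := 4) (σ := σ3) hn hL (by omega)
    (by omega) (by omega) (by omega) (by omega) (by omega) (by omega) (by omega) (by omega)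
    (by omega)
  refine ⟨σ4, (r1.seq (r2.seq (r3.seq r4))).mono ?_, ?_, ?_, ?_⟩
  · have t1 : 1 * L ≤ n * L := Nat.mul_le_mul_right _ hn
    omega
  · intro j hj
    rw [w4.keep j (by omega), k3 j (by omega), k2 j (by omega), k1 j hj]
  · rw [w4.keep 6 (by omega), k36, k26, e6]
  · intro k i
    rw [w4.fl_eq, w3.fl_eq, w2.fl_eq, hfl, k316, k317, k318, k36, k34, k26, k24, k216, k217, k218,
      k221, e20, e21, e18, ex, e6, k14, h4]
    by_cases hi : i = p
    · subst hi
      rcases Nat.lt_or_ge k 3 with h | h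
      · interval_cases k <;> simp [corrOf_of_two_le]
      · simp only [and_true, true_and]
        rw [if_neg (by omega), if_neg (by omega), if_neg (by omega), if_neg (by omega)]
    · simp [hi]

/-- Initialise the entries `0, …, reg 5` of the three arrays. -/
def initP (o : Option Family) : RamProg :=
  .seq (block [.move 6 5, .add 6 6 3]) (.loop 4 6 (initStepP o))

lemma Approx.exp_lt {L k : ℕ} {x : ℕ × ℕ} {v : ℕ} (h : Approx L k x v) (hk : k < 2 ^ L) :
    x.2 < 2 ^ L := h.exp_le.trans_lt hk

/-- Each pass reads and overwrites a single index, so unprocessed entries still hold the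
approximations of `b`. The growth `m + 1` of the budget comes from `Approx.scale` with `expOf o p ≤
m`. -/
lemma runs_initP {mc : ℕ → ℕ} {n L m K : ℕ} {o : Option Family} {σ : RamState} (hn : 1 ≤ n)
    (hL : 2 ≤ L) (hnL : n + 1 < 2 ^ L) (hK : K < 2 ^ L) (h2 : σ.reg 2 = L) (h3 : σ.reg 3 = 1)
    (h4 : σ.reg 4 = 0) (h5 : σ.reg 5 = m) (hm : m ≤ n) (b : ℕ → ℕ)
    (hb : ∀ p, Approx L K (fl σ 0 p) (b p)) :
    ∃ τ, Runs mc (initP o) σ (1500 * (n * (n * L))) τ ∧ (∀ j ≤ 5, τ.reg j = σ.reg j) ∧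
      (∀ p ≤ m, ∀ c < 3, Approx L (K + m + 1) (fl τ c p)
        ((2 ^ expOf o p - corrOf o m p c) * b p)) ∧
      ∀ p, m < p → fl τ 0 p = fl σ 0 p := by
  let Inv : ℕ → RamState → Prop := fun k τ => (∀ j ≤ 5, τ.reg j = σ.reg j) ∧
    τ.reg 6 = m + 1 - k ∧
    (∀ p ≤ m, m + 1 - k ≤ p → ∀ c < 3, Approx L (K + m + 1) (fl τ c p)
        ((2 ^ expOf o p - corrOf o m p c) * b p)) ∧
    ∀ p, (p < m + 1 - k ∨ m < p) → fl τ 0 p = fl σ 0 p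
  have r1 : Runs mc _ σ (2 * (1 + 2 * L)) _ := Runs.block
    (l := [.move 6 5, .add 6 6 3]) (S := L) (σ := σ) (by
      simp [AllReadsLt, ReadsLt, RamInstr.eval, RamState.setReg, Function.update]
      omega)
  set σ1 := evalL [.move 6 5, .add 6 6 3] σ with hσ1
  have k1 : ∀ j, j ≠ 6 → σ1.reg j = σ.reg j := by
    intro j hj
    simp [σ1, evalL, RamInstr.eval, RamState.setReg, Function.update, *]
  have a1 : σ1.arr = σ.arr := by simp [hσ1, evalL, RamInstr.eval, RamState.setReg]
  have e6 : σ1.reg 6 = m + 1 := by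
    simp [hσ1, evalL, RamInstr.eval, RamState.setReg, Function.update, h5, h3]
  have h0 : Inv 0 σ1 := by
    refine ⟨fun j hj => k1 j (by omega), by omega, fun p hp hp' => by omega, fun p _ => ?_⟩
    simp only [fl, a1]
  obtain ⟨τ, hr, i1, i2, i3, i4⟩ := Runs.loop (mc := mc) (x := 4) (y := 6) (p := initStepP o) Inv
    (S := L) (T := 700 * (n * L)) (N := m + 1)
    (fun k hk τ hτ => by
      obtain ⟨h1, h6, -⟩ := hτ
      have := h1 4 (by omega)
      omega)
    (fun k hk τ hτ => by
      obtain ⟨h1, h6, hA, hB⟩ := hτ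
      have q2 := h1 2 (by omega)
      have q3 := h1 3 (by omega)
      have q4 := h1 4 (by omega)
      have q5 := h1 5 (by omega)
      have hx := hB (m - k) (by omega)
      have hbx := hb (m - k)
      rw [← hx] at hbx
      obtain ⟨υ, r, u1, u6, u⟩ := runs_initStepP (mc := mc) (o := o) (p := m - k) (σ := τ) hn hL
        hnL (by omega) (by omega) (by omega) (q5.trans h5) hm (by omega) (by omega)
        hbx.lt (hbx.exp_lt hK)
      refine ⟨by omega, υ, r, fun j hj => (u1 j hj).trans (h1 j hj), by omega, ?_, ?_⟩
      · intro p hp hp' c hc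
        rw [u]
        split_ifs with h
        · obtain ⟨rfl, -⟩ := h
          refine (hbx.scale hL _ _).mono hL ?_
          have := expOf_le o (m - k)
          omega
        · exact hA p hp (by omega) c hc
      · intro p hp
        rw [u, if_neg (by omega)]
        exact hB p (by omega))
    (fun τ hτ => by
      obtain ⟨h1, h6, -⟩ := hτ
      omega) σ1 h0
  refine ⟨τ, (r1.seq hr).mono ?_, i1, fun p hp => i3 p hp (by omega), fun p hp => i4 p (.inr hp)⟩
  have t0 : 1 * L ≤ n * L := Nat.mul_le_mul_right _ hn
  have t1 : 1 * (n * L) ≤ n * (n * L) := Nat.mul_le_mul_right _ hn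
  have t2 : (m + 1) * (1 + 2 * L + 700 * (n * L)) ≤ (2 * n) * (703 * (n * L)) :=
    Nat.mul_le_mul (by omega) (by omega)
  have t3 : (2 * n) * (703 * (n * L)) = 1406 * (n * (n * L)) := by ring
  omega


/-! ### The Pascal-type triangular scheme. -/

/-- One step of the triangular scheme: update the entry `reg 6` of the three arrays. -/
def triStepP : RamProg :=
  .seq (block [.sub 8 6 3]) (.seq (accP 0 1) (.seq (accP 1 2) (.seq (accP 2 2)
    (block [.sub 6 6 3]))))

lemma runs_triStepP {mc : ℕ → ℕ} {L p : ℕ} {σ : RamState} (hL : 2 ≤ L) (h2 : σ.reg 2 = L)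
    (h3 : σ.reg 3 = 1) (h6 : σ.reg 6 = p + 1) (hp : p + 1 < 2 ^ L)
    (hx : ∀ c < 3, (fl σ c (p + 1)).1 < 2 ^ L ∧ (fl σ c (p + 1)).2 < 2 ^ L)
    (hy : ∀ c < 3, (fl σ c p).1 < 2 ^ L ∧ (fl σ c p).2 < 2 ^ L) :
    ∃ τ, Runs mc triStepP σ (310 * L) τ ∧ (∀ j ≤ 5, τ.reg j = σ.reg j) ∧ τ.reg 7 = σ.reg 7 ∧
      τ.reg 6 = p ∧ (∀ c i, i ≠ p + 1 → fl τ c i = fl σ c i) ∧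
      ∀ c < 3, fl τ c (p + 1) = addF L (fl σ c (p + 1)) (fl σ (min (c + 1) 2) p) := by
  have h1L : 1 < 2 ^ L := Nat.one_lt_two_pow (by omega)
  have r1 : Runs mc _ σ (1 * (1 + 2 * L)) _ := Runs.block (l := [.sub 8 6 3]) (S := L) (σ := σ) (by
      simp [AllReadsLt, ReadsLt]
      omega)
  set σ1 := evalL [.sub 8 6 3] σ with hσ1
  have k1 : ∀ j, j ≠ 8 → σ1.reg j = σ.reg j := by
    intro j hj
    simp [σ1, evalL, RamInstr.eval, RamState.setReg, Function.update, *]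
  have a1 : ∀ c i, fl σ1 c i = fl σ c i := by
    simp [hσ1, evalL, RamInstr.eval, RamState.setReg, fl]
  have e8 : σ1.reg 8 = p := by
    simp [hσ1, evalL, RamInstr.eval, RamState.setReg, h3, h6]
  have e6 : σ1.reg 6 = p + 1 := by rw [k1 6 (by omega), h6]
  have e2 : σ1.reg 2 = L := by rw [k1 2 (by omega), h2]
  obtain ⟨σ2, r2, w2⟩ := runs_accP (mc := mc) (k := 0) (k' := 1) hL e2 (by omega) (by omega)
    (by rw [a1, e6]; exact (hx 0 (by omega)).1) (by rw [a1, e6]; exact (hx 0 (by omega)).2)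
    (by rw [a1, e8]; exact (hy 1 (by omega)).1) (by rw [a1, e8]; exact (hy 1 (by omega)).2)
  have k2 := w2.keep
  have f2 := w2.fl_eq
  simp only [a1, e6, e8] at f2
  have e28 : σ2.reg 8 = p := by rw [k2 8 (by omega), e8]
  have e26 : σ2.reg 6 = p + 1 := by rw [k2 6 (by omega), e6]
  have e22 : σ2.reg 2 = L := by rw [k2 2 (by omega), e2]
  have g1 : fl σ2 1 (p + 1) = fl σ 1 (p + 1) := by simp [f2]
  have g2 : fl σ2 2 p = fl σ 2 p := by simp [f2]
  obtain ⟨σ3, r3, w3⟩ := runs_accP (mc := mc) (k := 1) (k' := 2) hL e22 (by omega) (by omega)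
    (by rw [e26, g1]; exact (hx 1 (by omega)).1) (by rw [e26, g1]; exact (hx 1 (by omega)).2)
    (by rw [e28, g2]; exact (hy 2 (by omega)).1) (by rw [e28, g2]; exact (hy 2 (by omega)).2)
  have k3 := w3.keep
  have f3 := w3.fl_eq
  simp only [g1, g2, e26, e28] at f3
  have e38 : σ3.reg 8 = p := by rw [k3 8 (by omega), e28]
  have e36 : σ3.reg 6 = p + 1 := by rw [k3 6 (by omega), e26]
  have e32 : σ3.reg 2 = L := by rw [k3 2 (by omega), e22]
  have g3 : fl σ3 2 (p + 1) = fl σ 2 (p + 1) := by simp [f3, f2]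
  have g4 : fl σ3 2 p = fl σ 2 p := by simp [f3, f2]
  obtain ⟨σ4, r4, w4⟩ := runs_accP (mc := mc) (k := 2) (k' := 2) hL e32 (by omega) (by omega)
    (by rw [e36, g3]; exact (hx 2 (by omega)).1) (by rw [e36, g3]; exact (hx 2 (by omega)).2)
    (by rw [e38, g4]; exact (hy 2 (by omega)).1) (by rw [e38, g4]; exact (hy 2 (by omega)).2)
  have k4 := w4.keep
  have f4 := w4.fl_eq
  simp only [g3, g4, e36, e38] at f4
  have e46 : σ4.reg 6 = p + 1 := by rw [k4 6 (by omega), e36]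
  have e43 : σ4.reg 3 = 1 := by
    rw [k4 3 (by omega), k3 3 (by omega), k2 3 (by omega), k1 3 (by omega), h3]
  have r5 : Runs mc _ σ4 (1 * (1 + 2 * L)) _ := Runs.block (l := [.sub 6 6 3]) (S := L) (σ := σ4) (by
      simp [AllReadsLt, ReadsLt]
      omega)
  set σ5 := evalL [.sub 6 6 3] σ4 with hσ5
  have k5 : ∀ j, j ≠ 6 → σ5.reg j = σ4.reg j := by
    intro j hj
    simp [σ5, evalL, RamInstr.eval, RamState.setReg, Function.update, *]
  have a5 : ∀ c i, fl σ5 c i = fl σ4 c i := by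
    simp [hσ5, evalL, RamInstr.eval, RamState.setReg, fl]
  have k15 : ∀ j < 8, j ≠ 6 → σ5.reg j = σ.reg j := fun j hj hj' => by
    rw [k5 j hj', k4 j (by omega), k3 j (by omega), k2 j (by omega), k1 j (by omega)]
  refine ⟨σ5, (r1.seq (r2.seq (r3.seq (r4.seq r5)))).mono (by omega),
    fun j hj => k15 j (by omega) (by omega), k15 7 (by omega) (by omega), ?_, ?_, ?_⟩
  · simp [hσ5, evalL, RamInstr.eval, RamState.setReg, e46, e43]
  · intro c i hi
    rw [a5, f4, if_neg (by omega), f3, if_neg (by omega), f2, if_neg (by omega)]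
  · intro c hc
    rw [a5, f4, f3, f2]
    interval_cases c <;> simp

/-- Replace the sequences `u` in the triangular scheme by their shift. -/
def shiftSeq (c : ℕ) (u : ℕ → ℕ → ℕ) : ℕ → ℕ → ℕ := fun i => u (i + c)

/-- Pascal's rule raises the shift by one; since `u` is constant in its first index from `2` on,
shifts beyond `2` are not needed and three arrays are closed under the recursion. -/
lemma binSum_shiftSeq_succ {u : ℕ → ℕ → ℕ} (hu : ∀ i, 2 ≤ i → u i = u 2) (r p : ℕ) {c : ℕ}
    (hc : c < 3) : binSum (r + 1) (shiftSeq c u) (p + 1) =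
      binSum r (shiftSeq c u) (p + 1) + binSum r (shiftSeq (min (c + 1) 2) u) p := by
  rw [binSum_succ, Nat.add_sub_cancel]
  congr 2
  funext i
  simp only [shiftSeq]
  rcases Nat.lt_or_ge c 2 with h | h
  · rw [show i + 1 + c = i + min (c + 1) 2 by omega]
  · rw [hu (i + 1 + c) (by omega), hu (i + min (c + 1) 2) (by omega)]

/-- One row of the triangular scheme. -/
def triRowP : RamProg := .seq (block [.move 6 5]) (.loop 7 6 triStepP)

/-- The state of the triangular scheme after `r` rows, and in the entries above `q` already after
`r + 1` rows. -/
structure TriInv (L K m : ℕ) (u : ℕ → ℕ → ℕ) (σ : RamState) (r q : ℕ) (τ : RamState) : Prop where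
  keep : ∀ j ≤ 5, τ.reg j = σ.reg j
  row : τ.reg 7 = r
  low : ∀ p ≤ m, p ≤ q → ∀ c < 3, Approx L (K + r) (fl τ c p) (binSum (min r p) (shiftSeq c u) p)
  high : ∀ p ≤ m, q < p → ∀ c < 3,
    Approx L (K + r + 1) (fl τ c p) (binSum (min (r + 1) p) (shiftSeq c u) p)
  rest : ∀ p, m < p → fl τ 0 p = fl σ 0 p

/-- Indices are treated downwards, so that entry `p` still belongs to row `r` when it is added to
entry `p + 1`; this permits working in place. The row stops at index `r`, because entry `p` needs
only `p` rows. -/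
lemma runs_triRowP {mc : ℕ → ℕ} {n L K m r : ℕ} {u : ℕ → ℕ → ℕ} {σ τ : RamState} (hn : 1 ≤ n)
    (hL : 2 ≤ L) (hnL : n + 1 < 2 ^ L) (hm : m ≤ n) (hK : K + m < 2 ^ L) (h2 : σ.reg 2 = L)
    (h3 : σ.reg 3 = 1) (h5 : σ.reg 5 = m) (hu : ∀ i, 2 ≤ i → u i = u 2) (hr : r < m)
    (h : TriInv L K m u σ r m τ) :
    ∃ υ, Runs mc triRowP τ (320 * (n * L)) υ ∧ TriInv L K m u σ r r υ := by
  have h55 := h.keep 5 (by omega)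
  have r1 : Runs mc _ τ (1 * (1 + 2 * L)) _ := Runs.block (l := [.move 6 5]) (S := L) (σ := τ) (by
      simp [AllReadsLt, ReadsLt]
      omega)
  set τ1 := evalL [.move 6 5] τ with hτ1
  have k1 : ∀ j, j ≠ 6 → τ1.reg j = τ.reg j := by
    intro j hj
    simp [τ1, evalL, RamInstr.eval, RamState.setReg, Function.update, *]
  have a1 : ∀ c i, fl τ1 c i = fl τ c i := by
    simp [hτ1, evalL, RamInstr.eval, RamState.setReg, fl]
  have e6 : τ1.reg 6 = m := by
    simp [hτ1, evalL, RamInstr.eval, RamState.setReg, h55, h5]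
  let Inv : ℕ → RamState → Prop := fun k ρ => TriInv L K m u σ r (m - k) ρ ∧ ρ.reg 6 = m - k
  have h0 : Inv 0 τ1 := by
    refine ⟨⟨fun j hj => ?_, ?_, ?_, ?_, ?_⟩, by simpa using e6⟩
    · rw [k1 j (by omega), h.keep j hj]
    · rw [k1 7 (by omega), h.row]
    · simpa [a1] using h.low
    · intro p hp hp'; omega
    · simpa [a1] using h.rest
  obtain ⟨υ, hυ, i1, i2⟩ := Runs.loop (mc := mc) (x := 7) (y := 6) (p := triStepP) Inv
    (S := L) (T := 310 * L) (N := m - r)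
    (fun k hk ρ hρ => by
      have := hρ.1.row
      have := hρ.2
      omega)
    (fun k hk ρ hρ => by
      obtain ⟨hI, hρ6⟩ := hρ
      have hrow := hI.row
      obtain ⟨p, hp⟩ : ∃ p, m - k = p + 1 := ⟨m - k - 1, by omega⟩
      rw [hp] at hI hρ6
      have b1 := hI.low (p + 1) (by omega) le_rfl
      have b2 := hI.low p (by omega) (by omega)
      obtain ⟨ρ', hr', g1, g7, g6, g3, g4⟩ := runs_triStepP (mc := mc) hL
        ((hI.keep 2 (by omega)).trans h2) ((hI.keep 3 (by omega)).trans h3) hρ6 (by omega)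
        (fun c hc => ⟨(b1 c hc).lt, (b1 c hc).exp_lt (by omega)⟩)
        (fun c hc => ⟨(b2 c hc).lt, (b2 c hc).exp_lt (by omega)⟩)
      refine ⟨by omega, ρ', hr', ?_, by omega⟩
      rw [show m - (k + 1) = p by omega]
      refine ⟨fun j hj => (g1 j hj).trans (hI.keep j hj), g7.trans hrow, ?_, ?_, ?_⟩
      · intro p' hp' hp'' c hc
        rw [g3 c p' (by omega)]
        exact hI.low p' hp' (by omega) c hc
      · intro p' hp' hp'' c hc
        rcases eq_or_ne p' (p + 1) with rfl | hne
        · rw [g4 c hc, show min (r + 1) (p + 1) = r + 1 by omega, binSum_shiftSeq_succ hu r p hc]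
          have d1 := b1 c hc
          have d2 := b2 (min (c + 1) 2) (by omega)
          rw [show min r (p + 1) = r by omega] at d1
          rw [show min r p = r by omega] at d2
          exact d1.add hL d2
        · rw [g3 c p' hne]
          exact hI.high p' hp' (by omega) c hc
      · intro p' hp'
        rw [g3 0 p' (by omega)]
        exact hI.rest p' hp')
    (fun ρ hρ => by
      have := hρ.1.row
      have := hρ.2
      omega) τ1 h0
  rw [show m - (m - r) = r by omega] at i1
  refine ⟨υ, (r1.seq hυ).mono ?_, i1⟩
  have t0 : 1 * L ≤ n * L := Nat.mul_le_mul_right _ hn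
  have t2 : (m - r) * (1 + 2 * L + 310 * L) ≤ n * (313 * L) :=
    Nat.mul_le_mul (by omega) (by omega)
  have t3 : n * (313 * L) = 313 * (n * L) := by ring
  omega

/-- The triangular scheme. -/
def triP : RamProg :=
  .seq (block [.const 7 0]) (.loop 7 5 (.seq triRowP (block [.add 7 7 3])))

lemma runs_triP {mc : ℕ → ℕ} {n L K m : ℕ} {u : ℕ → ℕ → ℕ} {σ : RamState} (hn : 1 ≤ n)
    (hL : 2 ≤ L) (hnL : n + 1 < 2 ^ L) (hm : m ≤ n) (hK : K + m < 2 ^ L) (h2 : σ.reg 2 = L)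
    (h3 : σ.reg 3 = 1) (h5 : σ.reg 5 = m) (hu : ∀ i, 2 ≤ i → u i = u 2)
    (h : ∀ p ≤ m, ∀ c < 3, Approx L K (fl σ c p) (u c p)) :
    ∃ τ, Runs mc triP σ (340 * (n * (n * L))) τ ∧ (∀ j ≤ 5, τ.reg j = σ.reg j) ∧
      (∀ p ≤ m, Approx L (K + m) (fl τ 0 p) (binSum p u p)) ∧
      ∀ p, m < p → fl τ 0 p = fl σ 0 p := by
  have r1 : Runs mc _ σ (1 * (1 + 2 * L)) _ := Runs.block (l := [.const 7 0]) (S := L) (σ := σ) (by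
      simp [AllReadsLt, ReadsLt])
  set σ1 := evalL [.const 7 0] σ with hσ1
  have k1 : ∀ j, j ≠ 7 → σ1.reg j = σ.reg j := by
    intro j hj
    simp [σ1, evalL, RamInstr.eval, RamState.setReg, Function.update, *]
  have a1 : ∀ c i, fl σ1 c i = fl σ c i := by
    simp [hσ1, evalL, RamInstr.eval, RamState.setReg, fl]
  have e7 : σ1.reg 7 = 0 := by
    simp [hσ1, evalL, RamInstr.eval, RamState.setReg]
  have h0 : TriInv L K m u σ 0 m σ1 := by
    refine ⟨fun j hj => k1 j (by omega), e7, ?_, fun p hp hp' => by omega, ?_⟩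
    · intro p hp _ c hc
      simpa [a1, shiftSeq] using h p hp c hc
    · simp [a1]
  obtain ⟨τ, hτ, i1⟩ := Runs.loop (mc := mc) (x := 7) (y := 5)
    (p := .seq triRowP (block [.add 7 7 3])) (fun r ρ => TriInv L K m u σ r m ρ)
    (S := L) (T := 323 * (n * L)) (N := m)
    (fun r hr ρ hρ => by
      have := hρ.row
      have := hρ.keep 5 (by omega)
      omega)
    (fun r hr ρ hρ => by
      have hrow := hρ.row
      have hr5 := hρ.keep 5 (by omega)
      obtain ⟨υ, hυ, hI⟩ := runs_triRowP (mc := mc) hn hL hnL hm hK h2 h3 h5 hu hr hρ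
      have j7 := hI.row
      have j3 := hI.keep 3 (by omega)
      refine ⟨by omega, _, (hυ.seq (Runs.block (l := [.add 7 7 3]) (S := L) ?_)).mono ?_, ?_⟩
      · simp [AllReadsLt, ReadsLt]
        omega
      · have t0 : 1 * L ≤ n * L := Nat.mul_le_mul_right _ hn
        simp only [List.length_singleton]
        omega
      · have aa : ∀ c i, fl (evalL [.add 7 7 3] υ) c i = fl υ c i := by
          simp [evalL, RamInstr.eval, RamState.setReg, fl]
        refine ⟨fun j hj => ?_, ?_, ?_, fun p hp hp' => by omega, ?_⟩
        · rw [← hI.keep j hj]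
          have : j ≠ 7 := by omega
          simp [evalL, RamInstr.eval, RamState.setReg, Function.update, this]
        · simp [evalL, RamInstr.eval, RamState.setReg, j7, j3, h3]
        · intro p hp _ c hc
          rw [aa]
          -- Entries with `p ≤ r` are already final, and both minima equal `p`.
          rcases Nat.lt_or_ge r p with hlt | hge
          · exact hI.high p hp hlt c hc
          · have := hI.low p hp hge c hc
            rw [min_eq_right hge] at this
            rw [min_eq_right (by omega)]
            exact this.mono hL (by omega)
        · intro p hp
          rw [aa]
          exact hI.rest p hp)
    (fun ρ hρ => by
      have := hρ.row
      have := hρ.keep 5 (by omega)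
      omega) σ1 h0
  refine ⟨τ, (r1.seq hτ).mono ?_, i1.keep, ?_, i1.rest⟩
  · have t0 : 1 * L ≤ n * L := Nat.mul_le_mul_right _ hn
    have t1 : 1 * (n * L) ≤ n * (n * L) := Nat.mul_le_mul_right _ hn
    have t2 : m * (1 + 2 * L + 323 * (n * L)) ≤ n * (326 * (n * L)) :=
      Nat.mul_le_mul hm (by omega)
    have t3 : n * (326 * (n * L)) = 326 * (n * (n * L)) := by ring
    omega
  · intro p hp
    have := i1.low p hp hp 0 (by omega)
    rw [min_eq_right hp] at this
    exact this


/-! ### One level of the recurrence. -/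

lemma nsink_eq_zero (t : Family) {m p : ℕ} (h : m < p) : nsink t m p = 0 := by
  cases m with
  | zero => simp only [nsink]; rw [if_neg (by omega)]
  | succ m => simp only [nsink]; rw [if_neg (by omega)]

/-- Pass from the structures on `m` vertices to those on `m + 1` vertices. -/
def levelP (t : Family) : RamProg :=
  .seq (.seq (initP (some t)) triP) (block [.add 5 5 3])

/-- The state after `m` levels. -/
structure LevelInv (t : Family) (n L m : ℕ) (σ : RamState) : Prop where
  reg0 : σ.reg 0 = n
  reg2 : σ.reg 2 = L
  reg3 : σ.reg 3 = 1
  reg4 : σ.reg 4 = 0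
  reg5 : σ.reg 5 = m
  approx : ∀ p, Approx L (m ^ 2) (fl σ 0 p) (nsink t m p)

/-- The initialisation adds `m + 1` to the error budget and the `m` rows add `m`, which turns `m ^
2` into `(m + 1) ^ 2`. With `o = none` the same program performs the final sum over sink sets. -/
lemma runs_initP_triP {mc : ℕ → ℕ} {t : Family} {n L m : ℕ} {σ : RamState} (o : Option Family)
    (hn : 1 ≤ n) (hL : 2 ≤ L) (hnL : (n + 1) ^ 2 < 2 ^ L) (hm : m ≤ n)
    (h : LevelInv t n L m σ) :
    ∃ τ, Runs mc (.seq (initP o) triP) σ (1840 * (n * (n * L))) τ ∧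
      (∀ j ≤ 5, τ.reg j = σ.reg j) ∧
      (∀ p ≤ m, Approx L ((m + 1) ^ 2) (fl τ 0 p)
        (binSum p (fun i p' => (2 ^ expOf o p' - corrOf o m p' i) * nsink t m p') p)) ∧
      ∀ p, m < p → fl τ 0 p = fl σ 0 p := by
  have h1 : (m + 1) ^ 2 = m ^ 2 + m + 1 + m := by ring
  have h2 : (m + 1) ^ 2 ≤ (n + 1) ^ 2 := Nat.pow_le_pow_left (by omega) 2
  have h3 : n + 1 ≤ (n + 1) ^ 2 := Nat.le_self_pow (by norm_num) _
  obtain ⟨σ1, r1, k1, hA, hB⟩ := runs_initP (mc := mc) (o := o) (m := m) (K := m ^ 2) hn hL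
    (by omega) (by omega) h.reg2 h.reg3 h.reg4 h.reg5 hm _ h.approx
  obtain ⟨σ2, r2, k2, hC, hD⟩ := runs_triP (mc := mc) (m := m) (K := m ^ 2 + m + 1)
    (u := fun i p' => (2 ^ expOf o p' - corrOf o m p' i) * nsink t m p') (σ := σ1) hn hL
    (by omega) hm (by omega) ((k1 2 (by omega)).trans h.reg2) ((k1 3 (by omega)).trans h.reg3)
    ((k1 5 (by omega)).trans h.reg5)
    (fun i hi => by
      funext p
      rw [corrOf_of_two_le o m p i hi, corrOf_of_two_le o m p 2 le_rfl]) hA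
  refine ⟨σ2, (r1.seq r2).mono (by omega), fun j hj => (k2 j hj).trans (k1 j hj), ?_,
    fun p hp => (hD p hp).trans (hB p hp)⟩
  rw [h1]
  exact hC

lemma runs_levelP {mc : ℕ → ℕ} {t : Family} {n L m : ℕ} {σ : RamState} (hn : 1 ≤ n)
    (hL : 2 ≤ L) (hnL : (n + 1) ^ 2 < 2 ^ L) (hm : m < n) (h : LevelInv t n L m σ) :
    ∃ τ, Runs mc (levelP t) σ (1850 * (n * (n * L))) τ ∧ LevelInv t n L (m + 1) τ := by
  obtain ⟨σ2, r2, k2, hC, hD⟩ :=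
    runs_initP_triP (mc := mc) (some t) hn hL hnL hm.le h
  have h3 : n + 1 ≤ (n + 1) ^ 2 := Nat.le_self_pow (by norm_num) _
  have e5 := (k2 5 (by omega)).trans h.reg5
  have e3 := (k2 3 (by omega)).trans h.reg3
  have r3 : Runs mc _ σ2 (1 * (1 + 2 * L)) _ := Runs.block (l := [.add 5 5 3]) (S := L) (σ := σ2) (by
      simp [AllReadsLt, ReadsLt]
      omega)
  refine ⟨_, (r2.seq r3).mono ?_, ?_, ?_, ?_, ?_, ?_, ?_⟩
  · have t0 : 1 * L ≤ n * L := Nat.mul_le_mul_right _ hn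
    have t1 : 1 * (n * L) ≤ n * (n * L) := Nat.mul_le_mul_right _ hn
    omega
  · simpa [evalL, RamInstr.eval, RamState.setReg] using (k2 0 (by omega)).trans h.reg0
  · simpa [evalL, RamInstr.eval, RamState.setReg] using (k2 2 (by omega)).trans h.reg2
  · simpa [evalL, RamInstr.eval, RamState.setReg] using e3
  · simpa [evalL, RamInstr.eval, RamState.setReg] using (k2 4 (by omega)).trans h.reg4
  · simp [evalL, RamInstr.eval, RamState.setReg, e5, e3]
  · intro p
    have aa : fl (evalL [.add 5 5 3] σ2) 0 p = fl σ2 0 p := by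
      simp [evalL, RamInstr.eval, RamState.setReg, fl]
    rw [aa]
    -- Entries above `m` are untouched and approximate `0`, the correct value on the next level too.
    rcases Nat.lt_or_ge m p with hp | hp
    · rw [hD p hp]
      have := h.approx p
      rw [nsink_eq_zero t hp] at this
      have h0 : nsink t (m + 1) p = 0 := by
        simp only [nsink]
        rw [if_neg (by omega)]
      rw [h0]
      exact this.mono hL (Nat.pow_le_pow_left (by omega) 2)
    · have h0 := hC p hp
      have h1 : nsink t (m + 1) p = binSum p (fun i p' =>
          (2 ^ expOf (some t) p' - corrOf (some t) m p' i) * nsink t m p') p := by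
        simp only [nsink]
        rw [if_pos hp]
        rfl
      rw [h1]
      exact h0

/-! ### Choice of precision and the complete program. -/

/-- Compute the precision and the initial state. -/
def setupP : List RamInstr :=
  [.len 2 0, .add 2 2 2, .len 6 1, .add 2 2 6, .const 6 4, .add 2 2 6, .const 3 1, .store 0 4 3]

/-- The precision used by the program. -/
def precision (n q : ℕ) : ℕ := 2 * Nat.size n + Nat.size q + 4

lemma pow_precision (n q : ℕ) :
    16 * ((n + 1) ^ 2 * (q + 1)) ≤ 2 ^ precision n q := by
  have h1 : n + 1 ≤ 2 ^ Nat.size n := Nat.lt_size_self n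
  have h2 : q + 1 ≤ 2 ^ Nat.size q := Nat.lt_size_self q
  calc 16 * ((n + 1) ^ 2 * (q + 1)) ≤ 16 * ((2 ^ Nat.size n) ^ 2 * 2 ^ Nat.size q) := by gcongr
    _ = 2 ^ precision n q := by rw [precision]; ring

lemma runs_setupP {mc : ℕ → ℕ} (t : Family) (n q : ℕ) :
    ∃ τ, Runs mc (block setupP) (RamState.init n q) (8 * (1 + 2 * precision n q)) τ ∧
      LevelInv t n (precision n q) 0 τ := by
  set L := precision n q with hL
  have hLe : L = 2 * Nat.size n + Nat.size q + 4 := rfl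
  have h1 : n < 2 ^ L := lt_two_pow_of_size_le (by omega)
  have h2 : q < 2 ^ L := lt_two_pow_of_size_le (by omega)
  have h3 : L < 2 ^ L := Nat.lt_two_pow_self
  refine ⟨_, Runs.block (l := setupP) ?_, ?_, ?_, ?_, ?_, ?_, ?_⟩
  · simp [setupP, AllReadsLt, ReadsLt, RamInstr.eval, RamState.setReg, RamState.init,
      Function.update]
    omega
  · simp [setupP, evalL, RamInstr.eval, RamState.setReg, RamState.setArr, RamState.init,
      Function.update]
  · simp [setupP, evalL, RamInstr.eval, RamState.setReg, RamState.setArr, RamState.init,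
      Function.update]
    omega
  · simp [setupP, evalL, RamInstr.eval, RamState.setReg, RamState.setArr, RamState.init,
      Function.update]
  · simp [setupP, evalL, RamInstr.eval, RamState.setReg, RamState.setArr, RamState.init,
      Function.update]
  · simp [setupP, evalL, RamInstr.eval, RamState.setReg, RamState.setArr, RamState.init,
      Function.update]
  · intro p
    rcases Nat.eq_zero_or_pos p with rfl | hp
    · have : fl (evalL setupP (RamState.init n q)) 0 0 = (1, 0) := by
        simp [setupP, evalL, RamInstr.eval, RamState.setReg, RamState.setArr, RamState.init,
          Function.update, fl]
      rw [this]
      exact approx_one (by omega)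
    · have : fl (evalL setupP (RamState.init n q)) 0 p = (0, 0) := by
        have : p ≠ 0 := by omega
        simp [setupP, evalL, RamInstr.eval, RamState.setReg, RamState.setArr, RamState.init,
          Function.update, fl, this]
      rw [this, nsink_eq_zero t hp]
      exact approx_zero _ _

/-- The counting program. -/
def mainP (t : Family) : RamProg :=
  .seq (block setupP) (.seq (.loop 5 0 (levelP t)) (.seq (.seq (initP none) triP)
    (block [.load 10 0 0, .load 1 1 0, .move 0 10])))

lemma runs_mainP {mc : ℕ → ℕ} (t : Family) {n : ℕ} (hn : 1 ≤ n) (q : ℕ) :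
    ∃ τ, Runs mc (mainP t) (RamState.init n q) (4000 * (n * (n * (n * precision n q)))) τ ∧
      Approx (precision n q) ((n + 1) ^ 2) (τ.reg 0, τ.reg 1) (familyCount t n) := by
  obtain ⟨σ1, r1, i1⟩ := runs_setupP (mc := mc) t n q
  have hLe : precision n q = 2 * Nat.size n + Nat.size q + 4 := rfl
  have hpow := pow_precision n q
  set L := precision n q with hL
  have hL2 : 2 ≤ L := by omega
  have hnL : (n + 1) ^ 2 < 2 ^ L := by
    have h1 : (n + 1) ^ 2 * 1 ≤ (n + 1) ^ 2 * (q + 1) := Nat.mul_le_mul_left _ (by omega)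
    have h2 : 0 < (n + 1) ^ 2 := by positivity
    omega
  have hn1 : n + 1 ≤ (n + 1) ^ 2 := Nat.le_self_pow (by norm_num) _
  have hn2 : n < 2 ^ L := by omega
  obtain ⟨σ2, r2, i2⟩ := Runs.loop (mc := mc) (x := 5) (y := 0) (p := levelP t)
    (LevelInv t n L) (S := L) (T := 1850 * (n * (n * L))) (N := n)
    (fun m hm σ hσ => by rw [hσ.reg5, hσ.reg0]; omega)
    (fun m hm σ hσ => by
      rw [hσ.reg5, hσ.reg0]
      exact ⟨hm, runs_levelP hn hL2 hnL hm hσ⟩)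
    (fun σ hσ => by rw [hσ.reg5, hσ.reg0]) σ1 i1
  obtain ⟨σ3, r3, k3, h3, -⟩ := runs_initP_triP (mc := mc) none hn hL2 hnL le_rfl i2
  have hf := h3 n le_rfl
  have h0 : σ3.reg 0 = n := (k3 0 (by omega)).trans i2.reg0
  have hb := hf.exp_lt hnL
  have ha := hf.lt
  simp only [fl, mul_zero, zero_add] at ha hb
  refine ⟨_, (r1.seq (r2.seq (r3.seq (Runs.block (S := L) ?_)))).mono ?_, ?_⟩
  · simp [AllReadsLt, ReadsLt, RamInstr.eval, RamState.setReg, Function.update, h0, ha, hb, hn2]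
  · have t0 : 1 * L ≤ n * L := Nat.mul_le_mul_right _ hn
    have t1 : 1 * (n * L) ≤ n * (n * L) := Nat.mul_le_mul_right _ hn
    have t2 : 1 * (n * (n * L)) ≤ n * (n * (n * L)) := Nat.mul_le_mul_right _ hn
    have t3 : n * (1 + 2 * L + 1850 * (n * (n * L))) ≤ n * (1853 * (n * (n * L))) :=
      Nat.mul_le_mul_left _ (by omega)
    have t4 : n * (1853 * (n * (n * L))) = 1853 * (n * (n * (n * L))) := by ring
    simp only [List.length_cons, List.length_nil]
    omega
  · have e : ((evalL [.load 10 0 0, .load 1 1 0, .move 0 10] σ3).reg 0,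
        (evalL [.load 10 0 0, .load 1 1 0, .move 0 10] σ3).reg 1) = fl σ3 0 n := by
      simp [evalL, RamInstr.eval, RamState.setReg, Function.update, fl, h0]
    rw [e]
    simpa [expOf, corrOf, familyCount] using hf

lemma hasFastApproxCounter_familyCount (mulCost : ℕ → ℕ) (M : ℕ → ℝ)
    (hM_one : ∀ t : ℕ, 1 ≤ t → 1 ≤ M t) (t : Family) :
    HasFastApproxCounter mulCost M (familyCount t) := by
  refine ⟨mainP t, 40000, fun n ε hn hε hε1 => ?_⟩
  set q := ⌈1 / ε⌉₊ with hq
  obtain ⟨τ, ⟨c, hc, hexec⟩, hA⟩ := runs_mainP (mc := mulCost) t hn q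
  have hpow := pow_precision n q
  have hLe : precision n q = 2 * Nat.size n + Nat.size q + 4 := rfl
  set L := precision n q with hL
  set l := logRatio n ε with hl
  have hl1 : 1 ≤ l := le_max_left _ _
  have hn1 : (1 : ℝ) ≤ n := by exact_mod_cast hn
  have hnε : (n : ℝ) / ε ≤ 2 ^ l := by
    have h1 : Real.logb 2 (n / ε) ≤ l :=
      (Nat.le_ceil _).trans (by exact_mod_cast le_max_right _ _)
    rw [Real.logb_le_iff_le_rpow (by norm_num) (by positivity)] at h1
    exact_mod_cast h1
  have hnl : n ≤ 2 ^ l := by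
    have : (n : ℝ) ≤ 2 ^ l := (le_div_self (by positivity) hε hε1).trans hnε
    exact_mod_cast this
  have hql : q ≤ 2 ^ l := by
    rw [hq, Nat.ceil_le]
    push_cast
    refine le_trans ?_ hnε
    gcongr
  have hpl : 2 ^ l < 2 ^ (l + 1) := Nat.pow_lt_pow_right (by norm_num) (by omega)
  -- Both bit lengths are at most `l + 1`, so `L ≤ 3 * l + 7`.
  have hLl : L ≤ 10 * l := by
    have := size_le_of_lt (hnl.trans_lt hpl)
    have := size_le_of_lt (hql.trans_lt hpl)
    omega
  have hLl' : (L : ℝ) ≤ 10 * l := by exact_mod_cast hLl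
  have hl0 : (0 : ℝ) ≤ l := by positivity
  have hnL : (n + 1) ^ 2 < 2 ^ L := by
    have h1 : (n + 1) ^ 2 * 1 ≤ (n + 1) ^ 2 * (q + 1) := Nat.mul_le_mul_left _ (by omega)
    have h2 : 0 < (n + 1) ^ 2 := by positivity
    omega
  refine ⟨c, τ, hexec, ?_, ?_, ?_, ?_⟩
  · have h1 : Nat.size (τ.reg 0) ≤ L := size_le_of_lt hA.lt
    have h2 : Nat.size (τ.reg 1) ≤ L := size_le_of_lt (hA.exp_lt hnL)
    have h3 : ((Nat.size (τ.reg 0) + Nat.size (τ.reg 1) : ℕ) : ℝ) ≤ 2 * L := by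
      exact_mod_cast (by omega : Nat.size (τ.reg 0) + Nat.size (τ.reg 1) ≤ 2 * L)
    linarith
  · refine le_trans ?_ hA.le_val
    refine mul_le_mul_of_nonneg_right ?_ (Nat.cast_nonneg _)
    have hθ := theta_nonneg (L := L) (by omega)
    -- By Bernoulli, the total relative loss is at most `(n + 1) ^ 2 * (4 / 2 ^ L)`, which is at
    -- most `ε` by the choice of precision and `1 / ε ≤ q`.
    have hB := one_add_mul_le_pow (a := -(4 / 2 ^ L : ℝ)) (by linarith) ((n + 1) ^ 2)
    rw [← sub_eq_add_neg] at hB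
    refine le_trans ?_ hB
    have hqε : 1 ≤ ε * (q + 1) := by
      have h1 : 1 / ε ≤ q := Nat.le_ceil _
      rw [div_le_iff₀ hε] at h1
      linarith
    have hpow' : (16 : ℝ) * ((n + 1) ^ 2 * (q + 1)) ≤ 2 ^ L := by exact_mod_cast hpow
    have h2 : ((n : ℝ) + 1) ^ 2 * (4 / 2 ^ L) ≤ ε := by
      rw [← mul_div_assoc, div_le_iff₀ (by positivity)]
      calc ((n : ℝ) + 1) ^ 2 * 4 ≤ (n + 1) ^ 2 * 4 * (ε * (q + 1)) :=
            le_mul_of_one_le_right (by positivity) hqε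
        _ ≤ (n + 1) ^ 2 * 16 * (ε * (q + 1)) := by gcongr; norm_num
        _ = ε * (16 * ((n + 1) ^ 2 * (q + 1))) := by ring
        _ ≤ ε * 2 ^ L := by gcongr
    push_cast
    linarith
  · exact_mod_cast hA.val_le
  · have hM := hM_one l hl1
    calc (c : ℝ) ≤ ((4000 * (n * (n * (n * L))) : ℕ) : ℝ) := by exact_mod_cast hc
      _ = 4000 * (n ^ 3 * L) := by push_cast; ring
      _ ≤ 4000 * (n ^ 3 * (10 * l)) := by gcongr
      _ = 40000 * (n ^ 3 * l * 1) := by ring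
      _ ≤ 40000 * (n ^ 3 * l * M l) := by gcongr

end DagCount

-- The program uses no multiplications, so that only `1 ≤ M` matters for its running time.
theorem theorem2 (mulCost : ℕ → ℕ) (M : ℕ → ℝ)
    (hM_one : ∀ t : ℕ, 1 ≤ t → 1 ≤ M t)
    (hM_mono : ∀ s t : ℕ, 1 ≤ s → s ≤ t → M s ≤ M t)
    (h_mul : ∀ t : ℕ, 1 ≤ t → (mulCost t : ℝ) ≤ (t : ℝ) * M t) :
    HasFastApproxCounter mulCost M numDAG ∧
      HasFastApproxCounter mulCost M numEssentialDAG ∧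
      HasFastApproxCounter mulCost M numExtensionalDAG := by
  rw [funext DagCount.numDAG_eq, funext DagCount.numEssentialDAG_eq,
    funext DagCount.numExtensionalDAG_eq]
  exact ⟨DagCount.hasFastApproxCounter_familyCount mulCost M hM_one _,
    DagCount.hasFastApproxCounter_familyCount mulCost M hM_one _,
    DagCount.hasFastApproxCounter_familyCount mulCost M hM_one _⟩
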